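/- **Setting.** Let $\mathcal G=(\mathcal V,\mathcal E)$ be a finite digraph with $N$ nodes, where $e_{ij}\in\mathcal E$ means that $i$ receives the pulses of $j$; let $\mathcal N_i^+=\{j: e_{ij}\in\mathcal E\}$ and $d_i=|\mathcal N_i^+|$. The nodes are oscillators; those in $\mathcal F\subseteq\mathcal V$ are misbehaving, the others, $\mathcal R=\mathcal V\setminus\mathcal F$, $R=|\mathcal R|$, are normal. Fix $f\in\mathbb N$ and $\alpha\in(0,1]$. *Algorithm.* Every normal oscillator $i$ has a phase $\phi_i$ growing from $0$ to $1$ with slope $\omega_i$ (its frequency), a flag $\gamma_i$, a counter $c_i$, a multiset $\mathcal F_i$ of received frequencies, and two stored numbers $\bar z_i,\underline z_i$; initially $\gamma_i=c_i=\bar z_i=\underline z_i=0$ and $\mathcal F_i=\varnothing$. (1) When $\phi_i$ reaches $1$, node $i$ sets $\gamma_i=1$, resets $\phi_i$ to $0$ and sends a pulse carrying the value $\omega_i$ to its out-neighbors. (2) When $i$ receives a pulse carrying a frequency, it adds this value to $\mathcal F_i$ and increases $c_i$ by $1$. If $c_i$ becomes $f+1$, it sets $\bar z_i=1-\phi_i$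 if $\phi_i\in[0.5,1)$ and $\bar z_i=0$ otherwise; if $c_i$ becomes $d_i-f$, it sets $\underline z_i=-\phi_i$ if $\phi_i\in[0,0.5)$ and $\underline z_i=0$ otherwise. (3) When $\phi_i=0.5$ and $\gamma_i=1$: if $c_i>d_i$, node $i$ *detects an attack* and leaves $\phi_i,\omega_i$ unchanged. If $c_i\le d_i$, it replaces $\phi_i$ by $\phi_i+(\bar z_i+\underline z_i)/2$, removes the $f_i=f-(d_i-c_i)$ largest and the $f_i$ smallest values from $\mathcal F_i$, and replaces $\omega_i$ by a convex combination (with weights that may depend on time) of $\omega_i$ and the remaining values, all weights being at least $\alpha$. In both cases it then resets $\gamma_i=0$, $c_i=0$, $\mathcal F_i=\varnothing$. Misbehaving nodes may send pulses with arbitrary frequency values to their out-neighbors at arbitrary times. Only finitely many events happen in bounded time; simultaneous events are processed one after the other in any order. *Notions.* $\Delta(t)$ is the length of the shortest arc of the circle $\mathbb R/\mathbb Z$ containing the phases of all normal oscillators. $\mathcal G$ is *$r$-robust* if for any disjoint nonempty $\mathcal V_1,\mathcal V_2\subsetneq\mathcal V$ some node of $\mathcal V_1$ has at least $r$ in-neighbors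 outside $\mathcal V_1$, or some node of $\mathcal V_2$ has at least $r$ in-neighbors outside $\mathcal V_2$. The attack is *$f$-local* if $|\mathcal F\cap\mathcal N_i^+|\le f$ for every $i\in\mathcal R$. **Theorem.** Suppose that the attack is $f$-local, that $\mathcal G$ is $(2f+1)$-robust, that for all $i\in\mathcal R$ we have $\phi_i(0)\in[0,0.5)$ and $\omega_i(0)\in[1,1+\delta(0)]$ (for example, with $\delta(0)$ the largest difference of two initial frequencies, after normalization), and that $$\Delta(0)+\frac{4NR}{\alpha^{2NR}}\,\delta(0)<0.5 .$$ Then, in every execution of the algorithm, either some normal node detects an attack at some time, and this node does have a misbehaving in-neighbor, or the normal nodes achieve resilient synchronization, that is: 1. (safety) at all times $t$ (before and after every event), $\omega_i(t)\in[1,1+\delta(0)]$ for all $i\in\mathcal R$, and $\Delta(t)<0.5$; 2. (synchronization) for all $i,j\in\mathcal R$, as $t\to\infty$, the distance of $\phi_i(t)$ and $\phi_j(t)$ on the circle $\mathbb R/\mathbb Z$ tends to $0$ and $|\omega_i(t)-\omega_j(t)|\to0$. -/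

import Mathlib

noncomputable section

namespace PCO

/-! ### Graphs

In a network `G : Digraph V`, `G.Adj i j` means that node `i` receives the pulses of node `j`. -/

section Graph

variable {V : Type*} [Fintype V]

open Classical in
/-- The in-neighbours of `i`: the nodes whose pulses `i` receives. -/
def inNbrs (G : Digraph V) (i : V) : Finset V :=
  Finset.univ.filter fun j => G.Adj i j

/-- The in-degree of `i`. -/
def inDeg (G : Digraph V) (i : V) : ℕ := (inNbrs G i).card

/-- `r`-robustness of a digraph. -/
def IsRobust [DecidableEq V] (G : Digraph V) (r : ℕ) : Prop :=
  ∀ V₁ V₂ : Finset V, V₁.Nonempty → V₂.Nonempty → Disjoint V₁ V₂ →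
    V₁ ⊂ Finset.univ → V₂ ⊂ Finset.univ →
      (∃ i ∈ V₁, r ≤ (inNbrs G i \ V₁).card) ∨ (∃ i ∈ V₂, r ≤ (inNbrs G i \ V₂).card)

/-- The attack is `f`-local: every normal node (that is, every node outside the set `F` of
misbehaving nodes) has at most `f` misbehaving in-neighbours. -/
def IsLocalAttack [DecidableEq V] (G : Digraph V) (F : Finset V) (f : ℕ) : Prop :=
  ∀ i, i ∉ F → (F ∩ inNbrs G i).card ≤ f

end Graph

/-! ### The local algorithm -/

/-- The local state of an oscillator: phase `φ_i`, absolute frequency `ω_i`, flag `γ_i`,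
counter `c_i`, the collection of received frequencies (with multiplicity), and the two
stored values `z̄_i` and `z̲_i`. -/
structure Oscillator where
  phase : ℝ
  freq : ℝ
  flag : Bool
  count : ℕ
  recv : Multiset ℝ
  zUp : ℝ
  zLow : ℝ

namespace Oscillator

/-- The values of the auxiliary variables at the start of the algorithm. -/
def IsFresh (x : Oscillator) : Prop :=
  x.flag = false ∧ x.count = 0 ∧ x.recv = 0 ∧ x.zUp = 0 ∧ x.zLow = 0

/-- Firing: the flag is set and the phase is reset from `1` to `0`. -/
def fire (x : Oscillator) : Oscillator := { x with phase := 0, flag := true }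

/-- Reception of a pulse carrying the frequency `w`, by an oscillator of in-degree `d`:
`z̄` is recorded when the counter becomes `f + 1`, `z̲` when it becomes `d - f`. -/
def receive (f d : ℕ) (w : ℝ) (x : Oscillator) : Oscillator :=
  { x with
    count := x.count + 1
    recv := w ::ₘ x.recv
    zUp :=
      if x.count + 1 = f + 1 then
        (if 1 / 2 ≤ x.phase ∧ x.phase < 1 then 1 - x.phase else 0)
      else x.zUp
    zLow :=
      if x.count + 1 + f = d then
        (if 0 ≤ x.phase ∧ x.phase < 1 / 2 then -x.phase else 0)
      else x.zLow }

/-- The values that remain, in increasing order, when the `m` largest and the `m` smallest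
elements of `s` are removed. -/
def trim (m : ℕ) (s : Multiset ℝ) : List ℝ :=
  ((s.sort (· ≤ ·)).drop m).take (s.card - 2 * m)

/-- `x.Updates f d α y`: the action executed at phase `1/2` (with raised flag) may lead from the
local state `x` to `y`, for an oscillator of in-degree `d`. If the counter exceeds `d` (an attack
is detected), phase and frequency are kept. Otherwise the phase is moved by `(z̄ + z̲) / 2`,
and the frequency becomes a convex combination, with weights at least `α`, of the own frequency and
the received ones that survive the removal of the `f - (d - c)` largest and smallest. Finally
flag, counter and received frequencies are reset. -/
def Updates (f d : ℕ) (α : ℝ) (x y : Oscillator) : Prop :=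
  (if d < x.count then
    y.phase = x.phase ∧ y.freq = x.freq
  else
    y.phase = x.phase + (x.zUp + x.zLow) / 2 ∧
    ∃ (a₀ : ℝ) (a : Fin (trim (f - (d - x.count)) x.recv).length → ℝ),
      α ≤ a₀ ∧ (∀ l, α ≤ a l) ∧ a₀ + ∑ l, a l = 1 ∧
      y.freq = a₀ * x.freq + ∑ l, a l * (trim (f - (d - x.count)) x.recv).get l) ∧
  y.flag = false ∧ y.count = 0 ∧ y.recv = 0 ∧ y.zUp = x.zUp ∧ y.zLow = x.zLow

/-- Continuous evolution for a time `h`: the phase grows with slope `freq`. -/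
def flow (h : ℝ) (x : Oscillator) : Oscillator := { x with phase := x.phase + x.freq * h }

end Oscillator

/-! ### The networked hybrid system -/

/-- The events: a normal node fires, a normal node executes the action at phase `1/2`, or a
misbehaving node emits a pulse. In the latter case `msg i` is the (arbitrary) frequency value sent
to the out-neighbour `i`, or `none` if nothing is sent to `i`. -/
inductive Event (V : Type*) where
  | fire (i : V)
  | update (i : V)
  | attack (j : V) (msg : V → Option ℝ)

section Dynamics

variable {V : Type*} [Fintype V] [DecidableEq V]

open Classical in
/-- `Step G F f α e p q`: at the event `e`, the states of the normal nodes jump from `p` to `q`.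
The states of misbehaving nodes play no role. -/
def Step (G : Digraph V) (F : Finset V) (f : ℕ) (α : ℝ) (e : Event V)
    (p q : V → Oscillator) : Prop :=
  match e with
  | .fire j =>
      j ∉ F ∧ (p j).phase = 1 ∧
      ∀ i, i ∉ F →
        q i =
          if G.Adj i j then
            (if i = j then (p i).fire else p i).receive f (inDeg G i) (p j).freq
          else (if i = j then (p i).fire else p i)
  | .update j =>
      j ∉ F ∧ (p j).phase = 1 / 2 ∧ (p j).flag = true ∧
      (p j).Updates f (inDeg G j) α (q j) ∧
      ∀ i, i ∉ F → i ≠ j → q i = p i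
  | .attack j msg =>
      j ∈ F ∧
      ∀ i, i ∉ F →
        q i =
          match msg i with
          | some w => if G.Adj i j then (p i).receive f (inDeg G i) w else p i
          | none => p i

/-- An execution of the algorithm on the network `G`, with misbehaving nodes `F`. The number
`t k` is the time of the `k`-th event (`t 0 = 0` is the initial time), `s 0` is the initial state,
`s k` is the state just after the `k`-th event, and `e k` is the event at time `t (k + 1)`.
Simultaneous events are processed one after the other, in any order. Only finitely many events occur
in bounded time. -/
structure IsExecution (G : Digraph V) (F : Finset V) (f : ℕ) (α : ℝ)
    (t : ℕ → ℝ) (e : ℕ → Event V) (s : ℕ → V → Oscillator) : Prop where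
  time_zero : t 0 = 0
  time_mono : Monotone t
  time_tendsto : Filter.Tendsto t Filter.atTop Filter.atTop
  fresh : ∀ i, i ∉ F → (s 0 i).IsFresh
  /-- No normal phase flows beyond `1` without firing. -/
  phase_le : ∀ k i, i ∉ F → ((s k i).flow (t (k + 1) - t k)).phase ≤ 1
  /-- No normal phase flows beyond `1/2` with raised flag without executing the action. -/
  phase_le_of_flag : ∀ k i, i ∉ F → (s k i).flag = true →
    ((s k i).flow (t (k + 1) - t k)).phase ≤ 1 / 2
  step : ∀ k, Step G F f α (e k) (fun i => (s k i).flow (t (k + 1) - t k)) (s (k + 1))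

/-- At event `k`, the normal node `i` detects an attack: it executes the action at phase `1/2` with a
counter larger than its in-degree. -/
def DetectsAt (G : Digraph V) (F : Finset V) (e : ℕ → Event V) (s : ℕ → V → Oscillator)
    (k : ℕ) (i : V) : Prop :=
  i ∉ F ∧ e k = .update i ∧ inDeg G i < (s k i).count

end Dynamics

/-! ### Resilient synchronization -/

section Synchronization

variable {V : Type*}

/-- The length of the containing arc: the infimum of the lengths `L` of arcs `[a, a + L]` of the
circle `ℝ / ℤ` that contain the phases of all normal nodes. -/
def arcLength (F : Finset V) (φ : V → ℝ) : ℝ :=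
  sInf {L : ℝ | 0 ≤ L ∧ ∃ a : ℝ, ∀ i, i ∉ F → Int.fract (φ i - a) ≤ L}

/-- The hybrid times of an execution: pairs `(k, τ)` with `t k ≤ τ ≤ t (k + 1)`. At an event time,
the state before and the state after each event have their own hybrid time. -/
def hybridTimes (t : ℕ → ℝ) : Set (ℕ × ℝ) := {p | t p.1 ≤ p.2 ∧ p.2 ≤ t (p.1 + 1)}

/-- The filter `τ → ∞` on hybrid times `(k, τ)`. -/
def lateTimes (t : ℕ → ℝ) : Filter (ℕ × ℝ) :=
  Filter.comap Prod.snd Filter.atTop ⊓ Filter.principal (hybridTimes t)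

/-- The phase of node `i` at the hybrid time `p`. -/
def phaseAt (t : ℕ → ℝ) (s : ℕ → V → Oscillator) (p : ℕ × ℝ) (i : V) : ℝ :=
  ((s p.1 i).flow (p.2 - t p.1)).phase

/-- The frequency of node `i` at the hybrid time `p`. -/
def freqAt (s : ℕ → V → Oscillator) (p : ℕ × ℝ) (i : V) : ℝ := (s p.1 i).freq

/-- Resilient synchronization of the normal nodes, with `Ω = [1, 1 + δ₀]`. Phases are compared as
points of the circle `ℝ / ℤ`. -/
structure ResilientSync (F : Finset V) (δ₀ : ℝ) (t : ℕ → ℝ) (s : ℕ → V → Oscillator) : Prop where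
  safe_freq : ∀ p ∈ hybridTimes t, ∀ i, i ∉ F → freqAt s p i ∈ Set.Icc 1 (1 + δ₀)
  safe_arc : ∀ p ∈ hybridTimes t, arcLength F (phaseAt t s p) < 1 / 2
  sync_phase : ∀ i j, i ∉ F → j ∉ F →
    Filter.Tendsto
      (fun p => dist (phaseAt t s p i : UnitAddCircle) (phaseAt t s p j : UnitAddCircle))
      (lateTimes t) (nhds 0)
  sync_freq : ∀ i j, i ∉ F → j ∉ F →
    Filter.Tendsto (fun p => |freqAt s p i - freqAt s p j|) (lateTimes t) (nhds 0)

end Synchronization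

end PCO

end

/-! Cut the run of each normal node into rounds: a new round begins at each action at phase `1/2`,
and each round contains one firing. Let `T n i` and `W n i` be the firing time and the frequency of
node `i` in round `n`. Both sequences perform robust consensus.

Frequencies: if `c ≤ d` when `i` acts, all normal in-neighbours have been heard, so at most as many
other pulses arrived as `i` has misbehaving in-neighbours. Trimming then leaves only values between
normal ones (`resilientStep_freq`). Times: the jump `(z̄ + z̲) / 2` moves `T n i` half-way towards
the `(f + 1)`-st and the `(d - f)`-th pulse, which leaves it in the normal hull
(`resilientStep_time`). The next firing follows after a period lying between the extreme values of
`1 / W n j`. So `T` does averaging with weight `1/2`, up to a common shift and an error at most the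
spread of `W n`.

Contraction (`spread_contract`): look at the normal nodes within `ε` of the top and of the bottom of
the hull. By robustness and locality, while both sets are nonempty some node of one of them hears `f
+ 1` normal nodes outside its set and leaves the set, and no node enters if `ε` shrinks by the
factor `α` per round. After `R` rounds one set is empty, so the spread has shrunk by the factor `1 -
α ^ R / 2`, up to the errors. Hence the frequency spreads sum to at most `2 * R / α ^ R * δ`, and
the spread of the times stays below a constant `D`; both spreads are summable and tend to `0`.

The rounds are well defined only while the nodes interleave properly: nobody acts before all have
fired, and nobody fires while another still has to act in the previous round. This needs `D + δ < 1
/ 2`, which in turn rests on the rounds so far. The circle is broken by stating the bounds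
conditionally (`Controlled`) and carrying the invariant `RunInv` from event to event until a first
detection. Finally `RunInv.exists_rotation` turns closeness of `T n` and `W n` into closeness of the
phases at all times. -/

noncomputable section

namespace PCO

/-! ### Contraction of resilient averaging on a robust graph -/

section Contraction

variable {V : Type*} [Fintype V] [DecidableEq V]

/-- The normal in-neighbours of `i`. -/
def normalNbrs (G : Digraph V) (F : Finset V) (i : V) : Finset V := inNbrs G i \ F

/-- `y` is a possible outcome of a resilient averaging step at node `i`, when the values of the
normal nodes are given by `x`: it lies in the hull of the normal values, with weight at least `α`
on the own value, and weight at least `α` on a value at most (at least) `c` whenever `f + 1` normal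
in-neighbours have such values. -/
structure ResilientStep (G : Digraph V) (F : Finset V) (f : ℕ) (α : ℝ) (x : V → ℝ) (i : V)
    (y : ℝ) : Prop where
  le_hull : ∀ hi, (∀ j, j ∉ F → x j ≤ hi) → y ≤ α * x i + (1 - α) * hi
  ge_hull : ∀ lo, (∀ j, j ∉ F → lo ≤ x j) → α * x i + (1 - α) * lo ≤ y
  le_nbrs : ∀ hi c, (∀ j, j ∉ F → x j ≤ hi) → c ≤ hi →
    f + 1 ≤ ((normalNbrs G F i).filter fun j => x j ≤ c).card → y ≤ α * c + (1 - α) * hi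
  ge_nbrs : ∀ lo c, (∀ j, j ∉ F → lo ≤ x j) → lo ≤ c →
    f + 1 ≤ ((normalNbrs G F i).filter fun j => c ≤ x j).card → α * c + (1 - α) * lo ≤ y

theorem ResilientStep.mem_hull {G : Digraph V} {F : Finset V} {f : ℕ} {α : ℝ} {x : V → ℝ} {i : V}
    {y lo hi : ℝ} (h : ResilientStep G F f α x i y) (hi' : i ∉ F) (hα : 0 ≤ α)
    (hx : ∀ j, j ∉ F → lo ≤ x j ∧ x j ≤ hi) : lo ≤ y ∧ y ≤ hi := by
  have h1 := h.le_hull hi fun j hj => (hx j hj).2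
  have h2 := h.ge_hull lo fun j hj => (hx j hj).1
  have h3 := mul_le_mul_of_nonneg_left (hx i hi').1 hα
  have h4 := mul_le_mul_of_nonneg_left (hx i hi').2 hα
  constructor <;> linarith

/-- Of `2 * f + 1` in-neighbours outside `A`, locality allows only `f` to misbehave. -/
theorem card_normalNbrs_outside {G : Digraph V} {F : Finset V} {f : ℕ}
    (hlocal : IsLocalAttack G F f) {i : V} (hi : i ∉ F) {A : Finset V} {p : V → Prop}
    [DecidablePred p] (hA : ∀ j, j ∉ F → j ∉ A → p j) (h : 2 * f + 1 ≤ (inNbrs G i \ A).card) :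
    f + 1 ≤ ((normalNbrs G F i).filter p).card := by
  have h1 : inNbrs G i \ A ⊆ (F ∩ inNbrs G i) ∪ (normalNbrs G F i).filter p := by
    intro j hj
    simp only [Finset.mem_sdiff] at hj
    simp only [Finset.mem_union, Finset.mem_inter, Finset.mem_filter, normalNbrs, Finset.mem_sdiff]
    by_cases hF : j ∈ F
    · exact Or.inl ⟨hF, hj.1⟩
    · exact Or.inr ⟨⟨hj.1, hF⟩, hA j hF hj.2⟩
  have h2 := (Finset.card_le_card h1).trans (Finset.card_union_le _ _)
  have h3 := hlocal i hi
  omega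

/-- The normal nodes with values above `b`. -/
def upper (F : Finset V) (x : V → ℝ) (b : ℝ) : Finset V := Fᶜ.filter fun i => b < x i

/-- The normal nodes with values below `b`. -/
def lower (F : Finset V) (x : V → ℝ) (b : ℝ) : Finset V := Fᶜ.filter fun i => x i < b

/-- `x'` arises from `x` by a resilient averaging step at all normal nodes, followed by shifts
between `p` and `p + η`. -/
def PerturbedStep (G : Digraph V) (F : Finset V) (f : ℕ) (α p η : ℝ) (x x' : V → ℝ) : Prop :=
  ∀ i, i ∉ F → ∃ y, ResilientStep G F f α x i y ∧ y + p ≤ x' i ∧ x' i ≤ y + p + η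

variable {G : Digraph V} {F : Finset V} {f : ℕ} {α : ℝ}

theorem PerturbedStep.hull {p η lo hi : ℝ} {x x' : V → ℝ} (h : PerturbedStep G F f α p η x x')
    (hα : 0 ≤ α) (hx : ∀ j, j ∉ F → lo ≤ x j ∧ x j ≤ hi) :
    ∀ j, j ∉ F → lo + p ≤ x' j ∧ x' j ≤ hi + p + η := by
  intro j hj
  obtain ⟨y, hy, h1, h2⟩ := h j hj
  have := hy.mem_hull hj hα hx
  constructor <;> linarith

/-- No node enters the upper set: one at distance `ε` from the top keeps weight `α` on its own
value, hence ends at distance `α * ε` from the new top `hi + p + η`. -/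
theorem PerturbedStep.upper_subset {p η hi ε : ℝ} {x x' : V → ℝ}
    (h : PerturbedStep G F f α p η x x') (hα : 0 ≤ α) (hx : ∀ j, j ∉ F → x j ≤ hi) :
    upper F x' (hi + p + η - α * ε) ⊆ upper F x (hi - ε) := by
  intro i
  simp only [upper, Finset.mem_filter, Finset.mem_compl]
  rintro ⟨hi', h1⟩
  refine ⟨hi', ?_⟩
  obtain ⟨y, hy, h2, h3⟩ := h i hi'
  by_contra hc
  have h4 := hy.le_hull hi hx
  have := mul_le_mul_of_nonneg_left (not_lt.1 hc) hα
  linarith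

theorem PerturbedStep.lower_subset {p η lo ε : ℝ} {x x' : V → ℝ}
    (h : PerturbedStep G F f α p η x x') (hα : 0 ≤ α) (hx : ∀ j, j ∉ F → lo ≤ x j) :
    lower F x' (lo + p + α * ε) ⊆ lower F x (lo + ε) := by
  intro i
  simp only [lower, Finset.mem_filter, Finset.mem_compl]
  rintro ⟨hi', h1⟩
  refine ⟨hi', ?_⟩
  obtain ⟨y, hy, h2, h3⟩ := h i hi'
  by_contra hc
  have h4 := hy.ge_hull lo hx
  have := mul_le_mul_of_nonneg_left (not_lt.1 hc) hα
  linarith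

theorem disjoint_upper_lower {x : V → ℝ} {a b : ℝ} (hab : b ≤ a) :
    Disjoint (upper F x a) (lower F x b) := by
  rw [Finset.disjoint_left]
  intro i
  simp only [upper, lower, Finset.mem_filter]
  rintro ⟨_, h1⟩ ⟨_, h2⟩
  linarith

theorem ssubset_univ_of_disjoint {ι : Type*} [Fintype ι] {A B : Finset ι} (h : Disjoint A B) (hB : B.Nonempty) :
    A ⊂ Finset.univ := by
  obtain ⟨b, hb⟩ := hB
  refine Finset.ssubset_univ_iff.2 fun hA => ?_
  exact Finset.disjoint_left.1 h (hA ▸ Finset.mem_univ b) hb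

/-- Robustness, applied to the two extreme sets, supplies a node that hears `f + 1` normal nodes
outside its own set. The weight `α` on one of their values takes it out of that set. -/
theorem PerturbedStep.card_lt {p η lo hi ε : ℝ} {x x' : V → ℝ}
    (h : PerturbedStep G F f α p η x x') (hα : 0 ≤ α)
    (hlocal : IsLocalAttack G F f) (hrobust : IsRobust G (2 * f + 1))
    (hx : ∀ j, j ∉ F → lo ≤ x j ∧ x j ≤ hi) (hε : 0 ≤ ε) (hε' : 2 * ε ≤ hi - lo)
    (hU : (upper F x (hi - ε)).Nonempty) (hL : (lower F x (lo + ε)).Nonempty) :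
    (upper F x' (hi + p + η - α * ε)).card + (lower F x' (lo + p + α * ε)).card <
      (upper F x (hi - ε)).card + (lower F x (lo + ε)).card := by
  have hd := disjoint_upper_lower (F := F) (x := x) (show lo + ε ≤ hi - ε by linarith)
  have sU := h.upper_subset (ε := ε) hα fun j hj => (hx j hj).2
  have sL := h.lower_subset (ε := ε) hα fun j hj => (hx j hj).1
  rcases hrobust _ _ hU hL hd (ssubset_univ_of_disjoint hd hL)
    (ssubset_univ_of_disjoint hd.symm hU) with ⟨i, hi', hc⟩ | ⟨i, hi', hc⟩
  · have hiF : i ∉ F := by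
      have := (Finset.mem_filter.1 hi').1
      simpa using this
    have hcard := card_normalNbrs_outside hlocal hiF (p := fun j => x j ≤ hi - ε)
      (fun j hj hjA => by
        by_contra hcon
        exact hjA (Finset.mem_filter.2 ⟨by simpa using hj, not_le.1 hcon⟩)) hc
    obtain ⟨y, hy, h2, h3⟩ := h i hiF
    have h4 := hy.le_nbrs hi _ (fun j hj => (hx j hj).2) (by linarith) hcard
    refine add_lt_add_of_lt_of_le (Finset.card_lt_card ⟨sU, fun hs => ?_⟩)
      (Finset.card_le_card sL)
    have := (Finset.mem_filter.1 (hs hi')).2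
    linarith
  · have hiF : i ∉ F := by
      have := (Finset.mem_filter.1 hi').1
      simpa using this
    have hcard := card_normalNbrs_outside hlocal hiF (p := fun j => lo + ε ≤ x j)
      (fun j hj hjA => by
        by_contra hcon
        exact hjA (Finset.mem_filter.2 ⟨by simpa using hj, not_le.1 hcon⟩)) hc
    obtain ⟨y, hy, h2, h3⟩ := h i hiF
    have h4 := hy.ge_nbrs lo _ (fun j hj => (hx j hj).1) (by linarith) hcard
    refine add_lt_add_of_le_of_lt (Finset.card_le_card sU)
      (Finset.card_lt_card ⟨sL, fun hs => ?_⟩)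
    have := (Finset.mem_filter.1 (hs hi')).2
    linarith

/-- Induction on the number of rounds, with the total size of the two extreme sets as a decreasing
counter and `ε` replaced by `α * ε` each time. Once a set is empty it remains so, and the hull can
be cut by the current margin on that side. -/
theorem exists_hull_of_steps (hα : 0 < α) (hα1 : α ≤ 1)
    (hlocal : IsLocalAttack G F f) (hrobust : IsRobust G (2 * f + 1)) (r : ℕ) :
    ∀ (x : ℕ → V → ℝ) (p η : ℕ → ℝ) (lo hi ε : ℝ),
      (∀ l < r, 0 ≤ η l) →
      (∀ l < r, PerturbedStep G F f α (p l) (η l) (x l) (x (l + 1))) →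
      (∀ j, j ∉ F → lo ≤ x 0 j ∧ x 0 j ≤ hi) → 0 ≤ ε → 2 * ε ≤ hi - lo →
      (upper F (x 0) (hi - ε) = ∅ ∨ lower F (x 0) (lo + ε) = ∅ ∨
        (upper F (x 0) (hi - ε)).card + (lower F (x 0) (lo + ε)).card ≤ r) →
      ∃ lo' hi', (∀ j, j ∉ F → lo' ≤ x r j ∧ x r j ≤ hi') ∧
        hi' - lo' ≤ hi - lo + ∑ l ∈ Finset.range r, η l - α ^ r * ε := by
  induction r with
  | zero =>
    intro x p η lo hi ε hη hs hx hε hε' hc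
    have hc' : upper F (x 0) (hi - ε) = ∅ ∨ lower F (x 0) (lo + ε) = ∅ := by
      rcases hc with h | h | h
      · exact Or.inl h
      · exact Or.inr h
      · exact Or.inl (Finset.card_eq_zero.1 (by omega))
    rcases hc' with h | h
    · refine ⟨lo, hi - ε, fun j hj => ⟨(hx j hj).1, ?_⟩, by
        simp only [Finset.range_zero, Finset.sum_empty, pow_zero]; linarith⟩
      by_contra hcon
      have : j ∈ upper F (x 0) (hi - ε) :=
        Finset.mem_filter.2 ⟨by simpa using hj, not_le.1 hcon⟩
      simp [h] at this
    · refine ⟨lo + ε, hi, fun j hj => ⟨?_, (hx j hj).2⟩, by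
        simp only [Finset.range_zero, Finset.sum_empty, pow_zero]; linarith⟩
      by_contra hcon
      have : j ∈ lower F (x 0) (lo + ε) :=
        Finset.mem_filter.2 ⟨by simpa using hj, not_le.1 hcon⟩
      simp [h] at this
  | succ r ih =>
    intro x p η lo hi ε hη hs hx hε hε' hc
    have h0 := hs 0 (Nat.succ_pos r)
    have hη0 := hη 0 (Nat.succ_pos r)
    have hαε : α * ε ≤ ε := by nlinarith
    have sU := h0.upper_subset (ε := ε) hα.le fun j hj => (hx j hj).2
    have sL := h0.lower_subset (ε := ε) hα.le fun j hj => (hx j hj).1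
    obtain ⟨lo', hi', h1, h2⟩ := ih (fun l => x (l + 1)) (fun l => p (l + 1))
      (fun l => η (l + 1)) (lo + p 0) (hi + p 0 + η 0) (α * ε)
      (fun l hl => hη (l + 1) (by omega)) (fun l hl => hs (l + 1) (by omega))
      (h0.hull hα.le hx) (by positivity) (by linarith) (by
        by_cases hU : (upper F (x 0) (hi - ε)).Nonempty
        · by_cases hL : (lower F (x 0) (lo + ε)).Nonempty
          · right; right
            have := h0.card_lt hα.le hlocal hrobust hx hε hε' hU hL
            rcases hc with h | h | h
            · simp [h] at hU
            · simp [h] at hL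
            · show (upper F (x 1) _).card + (lower F (x 1) _).card ≤ r
              simp only [zero_add] at this
              omega
          · right; left
            rw [Finset.not_nonempty_iff_eq_empty] at hL
            exact Finset.subset_empty.1 (hL ▸ sL)
        · left
          rw [Finset.not_nonempty_iff_eq_empty] at hU
          exact Finset.subset_empty.1 (hU ▸ sU))
    refine ⟨lo', hi', h1, h2.trans (le_of_eq ?_)⟩
    rw [Finset.sum_range_succ']
    ring

/-- The diameter of the set of values of the normal nodes. -/
def spread (F : Finset V) (x : V → ℝ) : ℝ :=
  if h : Fᶜ.Nonempty then Fᶜ.sup' h x - Fᶜ.inf' h x else 0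

theorem exists_hull_spread (hF : Fᶜ.Nonempty) (x : V → ℝ) :
    ∃ lo hi, (∀ j, j ∉ F → lo ≤ x j ∧ x j ≤ hi) ∧ hi - lo = spread F x := by
  refine ⟨Fᶜ.inf' hF x, Fᶜ.sup' hF x, fun j hj => ?_, by simp [spread, hF]⟩
  have : j ∈ Fᶜ := by simpa using hj
  exact ⟨Finset.inf'_le _ this, Finset.le_sup' _ this⟩

theorem sub_le_spread {i j : V} (hi : i ∉ F) (hj : j ∉ F) (x : V → ℝ) :
    x i - x j ≤ spread F x := by
  obtain ⟨lo, hi', h1, h2⟩ := exists_hull_spread ⟨i, by simpa using hi⟩ x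
  linarith [(h1 i hi).2, (h1 j hj).1]

theorem exists_spread_eq (hF : Fᶜ.Nonempty) (x : V → ℝ) :
    ∃ i j, i ∉ F ∧ j ∉ F ∧ spread F x = x i - x j := by
  obtain ⟨i, hi, h1⟩ := Finset.exists_mem_eq_sup' hF x
  obtain ⟨j, hj, h2⟩ := Finset.exists_mem_eq_inf' hF x
  exact ⟨i, j, by simpa using hi, by simpa using hj, by simp [spread, hF, h1, h2]⟩

theorem spread_le {x : V → ℝ} {c : ℝ} (hF : Fᶜ.Nonempty)
    (h : ∀ i j, i ∉ F → j ∉ F → x i - x j ≤ c) : spread F x ≤ c := by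
  obtain ⟨i, j, hi, hj, h1⟩ := exists_spread_eq hF x
  exact h1 ▸ h i j hi hj

theorem spread_nonneg (x : V → ℝ) : 0 ≤ spread F x := by
  by_cases hF : Fᶜ.Nonempty
  · obtain ⟨i, hi⟩ := hF
    have := sub_le_spread (F := F) (by simpa using hi) (by simpa using hi) x (i := i) (j := i)
    linarith
  · simp [spread, hF]

theorem PerturbedStep.spread_le {p η : ℝ} {x x' : V → ℝ} (h : PerturbedStep G F f α p η x x')
    (hF : Fᶜ.Nonempty) (hα : 0 ≤ α) : spread F x' ≤ spread F x + η := by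
  obtain ⟨lo, hi, h1, h2⟩ := exists_hull_spread hF x
  have h3 := h.hull hα h1
  refine PCO.spread_le hF fun i j hi hj => ?_
  linarith [(h3 i hi).2, (h3 j hj).1]

theorem spread_contract (hα : 0 < α) (hα1 : α ≤ 1) (hF : Fᶜ.Nonempty)
    (hlocal : IsLocalAttack G F f) (hrobust : IsRobust G (2 * f + 1))
    {x : ℕ → V → ℝ} {p η : ℕ → ℝ} (hη : ∀ l < Fᶜ.card, 0 ≤ η l)
    (hs : ∀ l < Fᶜ.card, PerturbedStep G F f α (p l) (η l) (x l) (x (l + 1))) :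
    spread F (x Fᶜ.card) ≤ (1 - α ^ Fᶜ.card / 2) * spread F (x 0)
      + ∑ l ∈ Finset.range Fᶜ.card, η l := by
  obtain ⟨lo, hi, h1, h2⟩ := exists_hull_spread hF (x 0)
  have h0 := spread_nonneg (F := F) (x 0)
  obtain ⟨lo', hi', h3, h4⟩ := exists_hull_of_steps hα hα1 hlocal hrobust Fᶜ.card x p η lo hi
    -- The largest margin for which the two extreme sets are disjoint, so that together they have at
    -- most `Fᶜ.card` elements.
    ((hi - lo) / 2) hη hs h1 (by linarith) (by linarith) (by
      right; right
      rw [← Finset.card_union_of_disjoint (disjoint_upper_lower (by linarith))]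
      exact Finset.card_le_card (Finset.union_subset (Finset.filter_subset _ _)
        (Finset.filter_subset _ _)))
  have : spread F (x Fᶜ.card) ≤ hi' - lo' :=
    PCO.spread_le hF fun i j hi hj => by linarith [(h3 i hi).2, (h3 j hj).1]
  rw [h2] at h4
  linarith

/-- Sum the recursion over `l`: the first `R` terms are bounded by `C` each, the later ones by `q`
times the whole sum plus the errors. Only terms below `n` enter, since the recursion may be known
only for the rounds already completed. -/
theorem sum_le_of_contract {S E : ℕ → ℝ} {q C : ℝ} {R n : ℕ} (hq : 0 ≤ q)
    (hC : 0 ≤ C) (hS0 : ∀ l, 0 ≤ S l) (hE : ∀ l, 0 ≤ E l) (hS : ∀ l < n, S l ≤ C)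
    (hc : ∀ l, l + R < n → S (l + R) ≤ q * S l + E l) :
    (1 - q) * ∑ l ∈ Finset.range n, S l ≤ R * C + ∑ l ∈ Finset.range n, E l := by
  have hEn := Finset.sum_nonneg fun l (_ : l ∈ Finset.range n) => hE l
  have hSn := Finset.sum_nonneg fun l (_ : l ∈ Finset.range n) => hS0 l
  rcases le_total n R with h | h
  · have h1 : ∑ l ∈ Finset.range n, S l ≤ n * C := by
      simpa using Finset.sum_le_card_nsmul (Finset.range n) S C
        fun l hl => hS l (Finset.mem_range.1 hl)
    have h2 : (n : ℝ) * C ≤ R * C := by gcongr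
    have := mul_nonneg hq hSn
    linarith
  · obtain ⟨m, rfl⟩ := Nat.exists_eq_add_of_le h
    have h1 : ∑ l ∈ Finset.range R, S l ≤ R * C := by
      simpa using Finset.sum_le_card_nsmul (Finset.range R) S C
        fun l hl => hS l (by have := Finset.mem_range.1 hl; omega)
    have h2 : ∑ l ∈ Finset.range m, S (R + l) ≤ ∑ l ∈ Finset.range m, (q * S l + E l) :=
      Finset.sum_le_sum fun l hl => by
        have := Finset.mem_range.1 hl
        rw [add_comm]
        exact hc l (by omega)
    rw [Finset.sum_add_distrib, ← Finset.mul_sum] at h2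
    have hsub : Finset.range m ⊆ Finset.range (R + m) := Finset.range_subset_range.2 (by omega)
    have h3 : ∑ l ∈ Finset.range m, S l ≤ ∑ l ∈ Finset.range (R + m), S l :=
      Finset.sum_le_sum_of_subset_of_nonneg hsub fun l _ _ => hS0 l
    have h4 : ∑ l ∈ Finset.range m, E l ≤ ∑ l ∈ Finset.range (R + m), E l :=
      Finset.sum_le_sum_of_subset_of_nonneg hsub fun l _ _ => hE l
    have h5 := mul_le_mul_of_nonneg_left h3 hq
    have h6 := Finset.sum_range_add S R m
    linarith

end Contraction

/-! ### Order statistics and trimmed convex combinations -/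

section Trim

theorem countP_sort (s : Multiset ℝ) (p : ℝ → Prop) [DecidablePred p] :
    (s.sort (· ≤ ·)).countP (fun x => decide (p x)) = (s.filter p).card := by
  conv_rhs => rw [← Multiset.sort_eq s (· ≤ ·)]
  rw [Multiset.filter_coe, Multiset.coe_card, List.countP_eq_length_filter]

theorem sort_get_le {s : Multiset ℝ} {i j : ℕ} (hj : j < (s.sort (· ≤ ·)).length) (hij : i ≤ j) :
    (s.sort (· ≤ ·))[i]'(hij.trans_lt hj) ≤ (s.sort (· ≤ ·))[j] := by
  rcases hij.lt_or_eq with h | rfl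
  · exact List.pairwise_iff_getElem.1 (Multiset.pairwise_sort s (· ≤ ·)) i j _ hj h
  · exact le_rfl

/-- If all entries from index `i` on satisfy `p`, there are many of them. -/
theorem length_sub_le_card_filter {s : Multiset ℝ} {p : ℝ → Prop} [DecidablePred p] {i : ℕ}
    (h : ∀ j (hj : j < (s.sort (· ≤ ·)).length), i ≤ j → p ((s.sort (· ≤ ·))[j])) :
    s.card - i ≤ (s.filter p).card := by
  have h1 : ((s.sort (· ≤ ·)).drop i).countP (fun x => decide (p x)) =
      ((s.sort (· ≤ ·)).drop i).length := by
    rw [List.countP_eq_length]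
    intro x hx
    obtain ⟨l, hl, rfl⟩ := List.mem_iff_getElem.1 hx
    rw [List.getElem_drop]
    exact decide_eq_true (h _ _ (by omega))
  have h2 := (List.drop_sublist i (s.sort (· ≤ ·))).countP_le (p := fun x => decide (p x))
  rw [h1, List.length_drop, Multiset.length_sort, countP_sort] at h2
  exact h2

/-- If all entries below index `i` satisfy `p`, there are many of them. -/
theorem le_card_filter {s : Multiset ℝ} {p : ℝ → Prop} [DecidablePred p] {i : ℕ}
    (hi : i ≤ s.card)
    (h : ∀ j (hj : j < (s.sort (· ≤ ·)).length), j < i → p ((s.sort (· ≤ ·))[j])) :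
    i ≤ (s.filter p).card := by
  have h1 : ((s.sort (· ≤ ·)).take i).countP (fun x => decide (p x)) =
      ((s.sort (· ≤ ·)).take i).length := by
    rw [List.countP_eq_length]
    intro x hx
    obtain ⟨l, hl, rfl⟩ := List.mem_iff_getElem.1 hx
    rw [List.getElem_take]
    rw [List.length_take] at hl
    exact decide_eq_true (h _ _ (by omega))
  have h2 := (List.take_sublist i (s.sort (· ≤ ·))).countP_le (p := fun x => decide (p x))
  rw [h1, List.length_take, Multiset.length_sort, countP_sort, min_eq_left hi] at h2
  exact h2

theorem card_filter_add_card_filter_not (s : Multiset ℝ) (p q : ℝ → Prop) [DecidablePred p]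
    [DecidablePred q] (h : ∀ x, p x → ¬ q x) : (s.filter p).card + (s.filter q).card ≤ s.card := by
  have h1 : (s.filter q) ≤ s.filter fun x => ¬ p x :=
    Multiset.monotone_filter_right s fun x hq hp => h x hp hq
  have h2 := congrArg Multiset.card (Multiset.filter_add_not p s)
  rw [Multiset.card_add] at h2
  have := Multiset.card_le_card h1
  omega

theorem length_trim (m : ℕ) (s : Multiset ℝ) :
    (Oscillator.trim m s).length = s.card - 2 * m := by
  simp only [Oscillator.trim, List.length_take, List.length_drop, Multiset.length_sort]
  omega

theorem trim_getElem {m : ℕ} {s : Multiset ℝ} {l : ℕ} (hl : l < (Oscillator.trim m s).length) :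
    (Oscillator.trim m s)[l] = (s.sort (· ≤ ·))[m + l]'(by
      rw [length_trim] at hl; rw [Multiset.length_sort]; omega) := by
  simp [Oscillator.trim]

theorem mem_of_trim {m : ℕ} {s : Multiset ℝ} {l : ℕ} (hl : l < (Oscillator.trim m s).length) :
    (Oscillator.trim m s)[l] ∈ s := by
  rw [trim_getElem, ← Multiset.mem_sort (r := (· ≤ ·))]
  exact List.getElem_mem _

/-- A surviving entry has at least `m` entries after it in sorted order; if it exceeded `hi`, more
than `m` entries would. -/
theorem trim_le {m : ℕ} {s : Multiset ℝ} {hi : ℝ} (h : (s.filter fun x => hi < x).card ≤ m) {l : ℕ}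
    (hl : l < (Oscillator.trim m s).length) : (Oscillator.trim m s)[l] ≤ hi := by
  rw [trim_getElem]
  by_contra hc
  have := length_sub_le_card_filter (s := s) (p := fun x => hi < x) (i := m + l)
    fun j hj hij => (not_le.1 hc).trans_le (sort_get_le hj hij)
  rw [length_trim] at hl
  omega

theorem le_trim {m : ℕ} {s : Multiset ℝ} {lo : ℝ} (h : (s.filter fun x => x < lo).card ≤ m) {l : ℕ}
    (hl : l < (Oscillator.trim m s).length) : lo ≤ (Oscillator.trim m s)[l] := by
  rw [trim_getElem]
  by_contra hc
  rw [length_trim] at hl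
  have := le_card_filter (s := s) (p := fun x => x < lo) (i := m + l + 1) (by omega)
    fun j hj hij => (sort_get_le (i := j) (j := m + l) _ (by omega)).trans_lt (not_le.1 hc)
  omega

theorem exists_trim_le {m : ℕ} {s : Multiset ℝ} {c : ℝ} (h : m < (s.filter fun x => x ≤ c).card)
    (hm : 2 * m < s.card) : ∃ l : Fin (Oscillator.trim m s).length,
      (Oscillator.trim m s)[l] ≤ c := by
  -- The smallest survivor: only `m` entries precede it, and more than `m` are at most `c`.
  refine ⟨⟨0, by rw [length_trim]; omega⟩, ?_⟩
  rw [Fin.getElem_fin, trim_getElem]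
  by_contra hc
  have h1 := length_sub_le_card_filter (s := s) (p := fun x => c < x) (i := m)
    fun j hj hij => (not_le.1 hc).trans_le (sort_get_le hj hij)
  have h2 := card_filter_add_card_filter_not s (fun x => x ≤ c) (fun x => c < x)
    fun x hx => not_lt.2 hx
  omega

theorem exists_le_trim {m : ℕ} {s : Multiset ℝ} {c : ℝ} (h : m < (s.filter fun x => c ≤ x).card)
    (hm : 2 * m < s.card) : ∃ l : Fin (Oscillator.trim m s).length,
      c ≤ (Oscillator.trim m s)[l] := by
  have h0 := length_trim m s
  refine ⟨⟨s.card - 2 * m - 1, by omega⟩, ?_⟩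
  rw [Fin.getElem_fin, trim_getElem]
  by_contra hc
  have h1 := le_card_filter (s := s) (p := fun x => x < c) (i := s.card - m) (by omega)
    fun j hj hij => (sort_get_le (i := j) (j := m + (s.card - 2 * m - 1)) _
      (by omega)).trans_lt (not_le.1 hc)
  have h2 := card_filter_add_card_filter_not s (fun x => c ≤ x) (fun x => x < c)
    fun x hx => not_lt.2 hx
  omega

/-- The entry that is at most `c`, be it the own value or a received one, has weight at least `α`;
all the remaining weight sits on values at most `hi`. -/
theorem convex_le {n : ℕ} {α a₀ w c hi : ℝ} {a v : Fin n → ℝ} (hα : 0 ≤ α) (ha₀ : α ≤ a₀)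
    (ha : ∀ l, α ≤ a l) (hsum : a₀ + ∑ l, a l = 1) (hv : ∀ l, v l ≤ hi) (hw : w ≤ hi)
    (hc : c ≤ hi) (h : w ≤ c ∨ ∃ l, v l ≤ c) :
    a₀ * w + ∑ l, a l * v l ≤ α * c + (1 - α) * hi := by
  have hs : a₀ * hi + ∑ l, a l * hi = hi := by rw [← Finset.sum_mul, ← add_mul, hsum, one_mul]
  have h0 : a₀ * w ≤ a₀ * hi := mul_le_mul_of_nonneg_left hw (hα.trans ha₀)
  have hl : ∀ l, a l * v l ≤ a l * hi := fun l =>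
    mul_le_mul_of_nonneg_left (hv l) (hα.trans (ha l))
  rcases h with h | ⟨l, h⟩
  · have h1 : ∑ l, a l * v l ≤ ∑ l, a l * hi := Finset.sum_le_sum fun l _ => hl l
    nlinarith
  · have h1 : ∑ k, (a k * hi - a k * v k) ≥ a l * hi - a l * v l :=
      Finset.single_le_sum (f := fun k => a k * hi - a k * v k)
        (fun k _ => sub_nonneg.2 (hl k)) (Finset.mem_univ l)
    rw [Finset.sum_sub_distrib] at h1
    nlinarith [ha l]

theorem le_convex {n : ℕ} {α a₀ w c lo : ℝ} {a v : Fin n → ℝ} (hα : 0 ≤ α) (ha₀ : α ≤ a₀)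
    (ha : ∀ l, α ≤ a l) (hsum : a₀ + ∑ l, a l = 1) (hv : ∀ l, lo ≤ v l) (hw : lo ≤ w)
    (hc : lo ≤ c) (h : c ≤ w ∨ ∃ l, c ≤ v l) :
    α * c + (1 - α) * lo ≤ a₀ * w + ∑ l, a l * v l := by
  have := convex_le (w := -w) (c := -c) (hi := -lo) (v := fun l => -v l) hα ha₀ ha hsum
    (fun l => neg_le_neg (hv l)) (neg_le_neg hw) (neg_le_neg hc)
    (h.imp neg_le_neg fun ⟨l, hl⟩ => ⟨l, neg_le_neg hl⟩)
  simp only [mul_neg, Finset.sum_neg_distrib] at this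
  linarith

end Trim

/-! ### The frequency update as a resilient averaging step -/

section FrequencyStep

variable {V : Type*} [Fintype V] [DecidableEq V]

theorem card_normalNbrs_add (G : Digraph V) (F : Finset V) (i : V) :
    (normalNbrs G F i).card + (F ∩ inNbrs G i).card = inDeg G i := by
  rw [normalNbrs, inDeg, Finset.inter_comm, add_comm]
  exact Finset.card_inter_add_card_sdiff _ _

theorem card_filter_map_add {ι : Type*} (A : Finset ι) (w : ι → ℝ) (B : Multiset ℝ) (p : ℝ → Prop)
    [DecidablePred p] :
    ((A.val.map w + B).filter p).card = (A.filter fun j => p (w j)).card + (B.filter p).card := by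
  rw [Multiset.filter_add, Multiset.card_add, Multiset.filter_map, Multiset.card_map]
  rfl

/-- The frequency update, when all normal in-neighbours and at most as many further pulses as there
are misbehaving in-neighbours have been received. -/
theorem resilientStep_freq {G : Digraph V} {F : Finset V} {f : ℕ} {α : ℝ} (hα : 0 ≤ α)
    (hlocal : IsLocalAttack G F f) {i : V} (hi : i ∉ F)
    (hdeg : 2 * f + 1 ≤ inDeg G i ∨ inNbrs G i = ∅)
    {w : V → ℝ} {B s : Multiset ℝ} (hs : s = (normalNbrs G F i).val.map w + B)
    (hB : B.card ≤ (F ∩ inNbrs G i).card) {a₀ : ℝ} {m : ℕ}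
    (hm : m = f - (inDeg G i - s.card))
    {a : Fin (Oscillator.trim m s).length → ℝ}
    (ha₀ : α ≤ a₀) (ha : ∀ l, α ≤ a l) (hsum : a₀ + ∑ l, a l = 1) :
    ResilientStep G F f α w i
      (a₀ * w i + ∑ l, a l * (Oscillator.trim m s).get l) := by
  have hN := card_normalNbrs_add G F i
  have hF := hlocal i hi
  have hcard : s.card = (normalNbrs G F i).card + B.card := by
    rw [hs, Multiset.card_add, Multiset.card_map]; rfl
  have hnormal : ∀ j ∈ normalNbrs G F i, j ∉ F := fun j hj => (Finset.mem_sdiff.1 hj).2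
  -- The choice of `m` together with locality gives `B.card ≤ m`, and only values in `B` can lie
  -- outside the normal hull.
  have hle : ∀ hi, (∀ j, j ∉ F → w j ≤ hi) → ∀ l, (Oscillator.trim m s).get l ≤ hi := by
    intro hi h l
    refine trim_le ?_ l.2
    have : ((normalNbrs G F i).filter fun j => hi < w j) = ∅ :=
      Finset.filter_eq_empty_iff.2 fun j hj => not_lt.2 (h j (hnormal j hj))
    have h2 := Multiset.card_le_card (Multiset.filter_le (fun x => hi < x) B)
    rw [hs, card_filter_map_add, this, Finset.card_empty]
    omega
  have hge : ∀ lo, (∀ j, j ∉ F → lo ≤ w j) → ∀ l, lo ≤ (Oscillator.trim m s).get l := by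
    intro lo h l
    refine le_trim ?_ l.2
    have : ((normalNbrs G F i).filter fun j => w j < lo) = ∅ :=
      Finset.filter_eq_empty_iff.2 fun j hj => not_lt.2 (h j (hnormal j hj))
    have h2 := Multiset.card_le_card (Multiset.filter_le (fun x => x < lo) B)
    rw [hs, card_filter_map_add, this, Finset.card_empty]
    omega
  have hnbr : ∀ p : V → Prop, ∀ [DecidablePred p],
      f + 1 ≤ ((normalNbrs G F i).filter p).card → 2 * f + 1 ≤ inDeg G i := by
    intro p _ h
    rcases hdeg with hd | hd
    · exact hd
    · simp [normalNbrs, hd] at h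
  refine ⟨fun hi' h => ?_, fun lo h => ?_, fun hi' c h hc hn => ?_, fun lo c h hc hn => ?_⟩
  · exact convex_le hα ha₀ ha hsum (hle hi' h) (h i hi) (h i hi) (Or.inl le_rfl)
  · exact le_convex hα ha₀ ha hsum (hge lo h) (h i hi) (h i hi) (Or.inl le_rfl)
  -- With `d` the in-degree, `m ≤ f` and `s.card - 2 * m = (d - 2 * f) + (d - s.card) ≥ 1`: some
  -- entry survives, and trimming cannot remove all of the `f + 1` small values.
  · have hd := hnbr _ hn
    have h1 : ((normalNbrs G F i).filter fun j => w j ≤ c).card ≤ (s.filter fun x => x ≤ c).card := by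
      rw [hs, card_filter_map_add]; omega
    exact convex_le hα ha₀ ha hsum (hle hi' h) (h i hi) hc
      (Or.inr (exists_trim_le (by omega) (by omega)))
  · have hd := hnbr _ hn
    have h1 : ((normalNbrs G F i).filter fun j => c ≤ w j).card ≤ (s.filter fun x => c ≤ x).card := by
      rw [hs, card_filter_map_add]; omega
    exact le_convex hα ha₀ ha hsum (hge lo h) (h i hi) hc
      (Or.inr (exists_le_trim (by omega) (by omega)))

end FrequencyStep

/-! ### One node during one round -/

section Node

variable {V : Type*} [Fintype V] [DecidableEq V]

/-- `u` is a possible arrival time of the `c`-th pulse at node `i`, when the normal nodes fire at the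
times `T`, and at most as many other pulses arrive as `i` has misbehaving in-neighbours. -/
def IsPulseTime (G : Digraph V) (F : Finset V) (i : V) (T : V → ℝ) (c : ℕ) (u : ℝ) : Prop :=
  ((normalNbrs G F i).filter fun j => T j < u).card < c ∧
    c ≤ ((normalNbrs G F i).filter fun j => T j ≤ u).card + (F ∩ inNbrs G i).card

/-- Moving half-way towards the `(f + 1)`-st and the `(d - f)`-th pulse is a resilient averaging
step for the firing times. -/
theorem resilientStep_time {G : Digraph V} {F : Finset V} {f : ℕ}
    (hlocal : IsLocalAttack G F f) {i : V} (hi : i ∉ F) (hdeg : 2 * f + 1 ≤ inDeg G i)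
    {T : V → ℝ} {u v : ℝ} (hu : IsPulseTime G F i T (f + 1) u)
    (hv : IsPulseTime G F i T (inDeg G i - f) v) :
    ResilientStep G F f (1 / 2) T i ((min (T i) u + max (T i) v) / 2) := by
  have hN := card_normalNbrs_add G F i
  have hF := hlocal i hi
  have hnormal : ∀ j ∈ normalNbrs G F i, j ∉ F := fun j hj => (Finset.mem_sdiff.1 hj).2
  -- Fewer than `d - f` normal pulses precede `v`, while there are at least `d - f` of them in
  -- total.
  have hvle : ∀ hi, (∀ j, j ∉ F → T j ≤ hi) → v ≤ hi := by
    intro hi h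
    by_contra hc
    have h1 := hv.1
    rw [Finset.filter_true_of_mem fun j hj => (h j (hnormal j hj)).trans_lt (not_le.1 hc)] at h1
    omega
  -- Before the first normal pulse only misbehaving ones arrive, at most `f` of them.
  have hule : ∀ lo, (∀ j, j ∉ F → lo ≤ T j) → lo ≤ u := by
    intro lo h
    by_contra hc
    have h1 := hu.2
    rw [Finset.filter_false_of_mem fun j hj =>
      not_le.2 ((not_le.1 hc).trans_le (h j (hnormal j hj))), Finset.card_empty] at h1
    omega
  have m1 := min_le_left (T i) u
  have m2 := min_le_right (T i) u
  have m3 := le_max_left (T i) v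
  have m4 := le_max_right (T i) v
  refine ⟨fun hi' h => ?_, fun lo h => ?_, fun hi' c h hc hn => ?_, fun lo c h hc hn => ?_⟩
  · have := max_le (h i hi) (hvle hi' h)
    linarith
  · have := le_min (h i hi) (hule lo h)
    linarith
  · have h1 := max_le (h i hi) (hvle hi' h)
    have h2 : u ≤ c := by
      by_contra hcon
      have h3 : ((normalNbrs G F i).filter fun j => T j ≤ c).card ≤
          ((normalNbrs G F i).filter fun j => T j < u).card :=
        Finset.card_le_card (Finset.monotone_filter_right _
          fun j _ hj => lt_of_le_of_lt hj (not_le.1 hcon))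
      have := hu.1
      omega
    linarith
  · have h1 := le_min (h i hi) (hule lo h)
    -- If `v < c`, the `f + 1` normal pulses from `c` on are missing at time `v`, so at most `d - f
    -- - 1` pulses have arrived.
    have h2 : c ≤ v := by
      by_contra hcon
      have h3 : ((normalNbrs G F i).filter fun j => T j ≤ v).card ≤
          ((normalNbrs G F i).filter fun j => ¬ c ≤ T j).card :=
        Finset.card_le_card (Finset.monotone_filter_right _
          fun j _ hj => not_le.2 (lt_of_le_of_lt hj (not_le.1 hcon)))
      have h4 := Finset.card_filter_add_card_filter_not (s := normalNbrs G F i) (fun j => c ≤ T j)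
      have := hv.2
      omega
    linarith

theorem resilientStep_self {G : Digraph V} {F : Finset V} {f : ℕ} {i : V} (hi : i ∉ F)
    (hdeg : inNbrs G i = ∅) (T : V → ℝ) : ResilientStep G F f (1 / 2) T i (T i) := by
  refine ⟨fun hi' h => ?_, fun lo h => ?_, fun hi' c h hc hn => ?_, fun lo c h hc hn => ?_⟩
  · linarith [h i hi]
  · linarith [h i hi]
  · simp [normalNbrs, hdeg] at hn
  · simp [normalNbrs, hdeg] at hn

/-- The time at which an oscillator with the local state `x` at time `τ` fired last (if its flag is
raised) or will fire next (otherwise), if it evolves without jumps. -/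
def lineTime (x : Oscillator) (τ : ℝ) : ℝ :=
  if x.flag = true then τ - x.phase / x.freq else τ + (1 - x.phase) / x.freq

/-- The local state `x` of the normal node `i` at time `τ`, in a round in which the normal nodes
have firing times `T` and frequencies `w`, after the pulses of the normal in-neighbours in `S` and
further pulses with values `B` have been received. -/
structure NodeInv (G : Digraph V) (F : Finset V) (f : ℕ) (i : V) (T w : V → ℝ) (S : Finset V)
    (B : Multiset ℝ) (τ : ℝ) (x : Oscillator) : Prop where
  subset : S ⊆ normalNbrs G F i
  freq : x.freq = w i
  line : lineTime x τ = T i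
  nonneg : 0 ≤ x.phase
  recv : x.recv = S.val.map w + B
  count : x.count = S.card + B.card
  no_attack : F ∩ inNbrs G i = ∅ → B = 0
  up_mem : x.zUp ∈ Set.Icc 0 (1 / 2)
  low_mem : x.zLow ∈ Set.Icc (-(1 / 2)) 0
  isolated : inNbrs G i = ∅ → x.zUp = 0 ∧ x.zLow = 0
  up : B.card ≤ (F ∩ inNbrs G i).card → f + 1 ≤ x.count →
    ∃ u, IsPulseTime G F i T (f + 1) u ∧ x.zUp = w i * max 0 (T i - u)
  low : B.card ≤ (F ∩ inNbrs G i).card → inDeg G i ≤ x.count + f →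
    2 * f + 1 ≤ inDeg G i →
    ∃ v, IsPulseTime G F i T (inDeg G i - f) v ∧ x.zLow = -(w i * max 0 (v - T i))

variable {G : Digraph V} {F : Finset V} {f : ℕ} {i : V} {T w : V → ℝ} {S : Finset V}
  {B : Multiset ℝ} {τ : ℝ} {x : Oscillator}

theorem lineTime_flow (hx : x.freq ≠ 0) (τ h : ℝ) :
    lineTime (x.flow h) (τ + h) = lineTime x τ := by
  simp only [lineTime, Oscillator.flow]
  by_cases hfl : x.flag = true
  · simp only [hfl, if_true]
    field_simp
    ring
  · simp only [hfl, if_false, Bool.false_eq_true]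
    field_simp
    ring

theorem NodeInv.flow (hx : NodeInv G F f i T w S B τ x) (hw : 0 < w i) {h : ℝ} (hh : 0 ≤ h) :
    NodeInv G F f i T w S B (τ + h) (x.flow h) where
  subset := hx.subset
  freq := hx.freq
  line := by rw [lineTime_flow (by rw [hx.freq]; exact hw.ne'), hx.line]
  nonneg := add_nonneg hx.nonneg (mul_nonneg (by rw [hx.freq]; exact hw.le) hh)
  recv := hx.recv
  count := hx.count
  no_attack := hx.no_attack
  up_mem := hx.up_mem
  low_mem := hx.low_mem
  isolated := hx.isolated
  up := hx.up
  low := hx.low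

theorem NodeInv.fire (hx : NodeInv G F f i T w S B τ x) (hflag : x.flag = false)
    (hphase : x.phase = 1) : NodeInv G F f i T w S B τ x.fire where
  subset := hx.subset
  freq := hx.freq
  line := by rw [← hx.line]; simp [lineTime, Oscillator.fire, hflag, hphase]
  nonneg := le_rfl
  recv := hx.recv
  count := hx.count
  no_attack := hx.no_attack
  up_mem := hx.up_mem
  low_mem := hx.low_mem
  isolated := hx.isolated
  up := hx.up
  low := hx.low

theorem NodeInv.phase_of_flag (hx : NodeInv G F f i T w S B τ x) (hw : 0 < w i)
    (h : x.flag = true) : x.phase = w i * (τ - T i) := by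
  have := hx.line
  simp only [lineTime, h, if_true, hx.freq] at this
  rw [← this]
  field_simp
  ring

theorem NodeInv.phase_of_not_flag (hx : NodeInv G F f i T w S B τ x) (hw : 0 < w i)
    (h : x.flag = false) : x.phase = 1 - w i * (T i - τ) := by
  have := hx.line
  simp only [lineTime, h, hx.freq] at this
  rw [← this]
  simp
  field_simp
  ring

/-- If the pulse that arrives at time `τ` makes the counter equal to `c`, with
`f + 1 ≤ c ≤ d - f`, then `τ` is a possible arrival time of the `c`-th pulse, and the phase at this
moment measures the lead or lag of the node with respect to `τ`. -/
theorem NodeInv.isPulseTime (hx : NodeInv G F f i T w S B τ x) (hw : 0 < w i)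
    (hlocal : IsLocalAttack G F f) (hi : i ∉ F)
    (hphase : x.phase ≤ 1) (hphase' : x.flag = true → x.phase ≤ 1 / 2)
    {S' : Finset V} {B' : Multiset ℝ} (hS' : S' ⊆ normalNbrs G F i)
    (hcount : S'.card + B'.card = S.card + B.card + 1)
    (hall : S'.Nonempty → (∀ l ∈ normalNbrs G F i, T l < τ → l ∈ S) ∧ (∀ l ∈ S', T l ≤ τ) ∧
      ∀ l l', l ∉ F → l' ∉ F → w i * (T l - T l') < 1 / 2)
    (hB' : B'.card ≤ (F ∩ inNbrs G i).card) {c : ℕ} (hc : x.count + 1 = c) (hfc : f + 1 ≤ c)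
    (hcd : c + f ≤ inDeg G i) :
    IsPulseTime G F i T c τ ∧
    (if 1 / 2 ≤ x.phase ∧ x.phase < 1 then 1 - x.phase else 0) = w i * max 0 (T i - τ) ∧
    (if 0 ≤ x.phase ∧ x.phase < 1 / 2 then -x.phase else 0) = -(w i * max 0 (τ - T i)) := by
  have hN := card_normalNbrs_add G F i
  have hF := hlocal i hi
  have hcnt := hx.count
  -- Pulses outside `S'` number at most `f < c`, so some normal pulse has arrived; this activates
  -- the timing information in `hall`.
  have hS : S'.Nonempty := Finset.card_pos.1 (by omega)
  obtain ⟨h1, h2, h3⟩ := hall hS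
  refine ⟨⟨?_, ?_⟩, ?_⟩
  · have : ((normalNbrs G F i).filter fun j => T j < τ).card ≤ S.card :=
      Finset.card_le_card fun j hj => h1 j (Finset.mem_filter.1 hj).1 (Finset.mem_filter.1 hj).2
    omega
  · have : S'.card ≤ ((normalNbrs G F i).filter fun j => T j ≤ τ).card :=
      Finset.card_le_card fun j hj => Finset.mem_filter.2 ⟨hS' hj, h2 j hj⟩
    omega
  · obtain ⟨l, hl⟩ := hS
    have hlF : l ∉ F := (Finset.mem_sdiff.1 (hS' hl)).2
    have hlτ := h2 l hl
    cases hflag : x.flag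
    · have hp := hx.phase_of_not_flag hw hflag
      have hTi : 0 ≤ T i - τ := by
        by_contra hcon
        have := mul_pos_of_neg_of_neg (not_le.1 hcon) (neg_neg_of_pos hw)
        linarith
      have h4 := h3 i l hi hlF
      have h5 : w i * (T i - τ) ≤ w i * (T i - T l) :=
        mul_le_mul_of_nonneg_left (by linarith) hw.le
      have hge : 1 / 2 ≤ x.phase := by linarith
      rw [max_eq_right hTi, max_eq_left (by linarith),
        if_neg fun h : 0 ≤ x.phase ∧ x.phase < 1 / 2 => h.2.not_ge hge]
      refine ⟨?_, by simp⟩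
      split_ifs with hcase
      · linarith
      · have : ¬ x.phase < 1 := fun h => hcase ⟨by linarith, h⟩
        linarith
    · have hp := hx.phase_of_flag hw hflag
      have hTi : 0 ≤ τ - T i := by
        by_contra hcon
        have := mul_neg_of_pos_of_neg hw (not_le.1 hcon)
        linarith [hx.nonneg]
      have hlt : x.phase < 1 / 2 := by
        refine lt_of_le_of_ne (hphase' hflag) fun heq => ?_
        -- At phase exactly `1/2` every normal in-neighbour would have fired earlier and been
        -- counted, so the counter would already be at least `d - f`.
        have hsub : normalNbrs G F i ⊆ S := fun j hj => h1 j hj (by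
          have h6 := h3 j i (Finset.mem_sdiff.1 hj).2 hi
          have h7 : w i * (T j - T i) < w i * (τ - T i) := by linarith
          have := lt_of_mul_lt_mul_left h7 hw.le
          linarith)
        have := Finset.card_le_card hsub
        omega
      rw [max_eq_right hTi, max_eq_left (by linarith),
        if_neg fun h : 1 / 2 ≤ x.phase ∧ x.phase < 1 => h.1.not_gt hlt,
        if_pos ⟨hx.nonneg, hlt⟩, hp]
      exact ⟨by simp, rfl⟩

/-- One statement for normal pulses (`S` grows) and misbehaving ones (`B` grows). `hall` is
conditional because a node that is already in its new round may hear misbehaving pulses while others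
are still in the old one. -/
theorem NodeInv.receive (hx : NodeInv G F f i T w S B τ x) (hw : 0 < w i)
    (hlocal : IsLocalAttack G F f) (hi : i ∉ F) (hdeg : 2 * f + 1 ≤ inDeg G i)
    (hphase : x.phase ≤ 1) (hphase' : x.flag = true → x.phase ≤ 1 / 2)
    {S' : Finset V} {B' : Multiset ℝ} {c : ℝ} (hS' : S' ⊆ normalNbrs G F i)
    (hrecv : S'.val.map w + B' = c ::ₘ (S.val.map w + B))
    (hB : B.card ≤ B'.card) (hB' : F ∩ inNbrs G i = ∅ → B' = 0)
    (hall : S'.Nonempty → (∀ l ∈ normalNbrs G F i, T l < τ → l ∈ S) ∧ (∀ l ∈ S', T l ≤ τ) ∧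
      ∀ l l', l ∉ F → l' ∉ F → w i * (T l - T l') < 1 / 2) :
    NodeInv G F f i T w S' B' τ (x.receive f (inDeg G i) c) := by
  have hcount : S'.card + B'.card = S.card + B.card + 1 := by
    have := congrArg Multiset.card hrecv
    simpa using this
  have key := fun hB' => hx.isPulseTime (c := x.count + 1) hw hlocal hi hphase hphase' hS' hcount
    hall hB' rfl
  have hup := hx.up_mem
  have hlow := hx.low_mem
  refine ⟨hS', hx.freq, hx.line, hx.nonneg, ?_, ?_, hB', ?_, ?_, ?_, ?_, ?_⟩
  · rw [hrecv, ← hx.recv]; rfl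
  · rw [hcount, ← hx.count]; rfl
  · show (if _ then (if _ then _ else _) else _) ∈ _
    split_ifs with h1 h2
    · constructor <;> linarith
    · constructor <;> norm_num
    · exact hup
  · show (if _ then (if _ then _ else _) else _) ∈ _
    split_ifs with h1 h2
    · constructor <;> linarith
    · constructor <;> norm_num
    · exact hlow
  · intro h
    simp [inDeg, h] at hdeg
  · intro hBm hc
    by_cases h : x.count + 1 = f + 1
    · obtain ⟨h1, h2, -⟩ := key hBm h.ge (by omega)
      refine ⟨τ, h ▸ h1, ?_⟩
      rw [← h2]
      exact if_pos h
    · obtain ⟨u, h1, h2⟩ := hx.up (hB.trans hBm) (by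
        change f + 1 ≤ x.count + 1 at hc
        omega)
      refine ⟨u, h1, ?_⟩
      rw [← h2]
      exact if_neg h
  · intro hBm hc _
    change inDeg G i ≤ x.count + 1 + f at hc
    by_cases h : x.count + 1 + f = inDeg G i
    · obtain ⟨h1, -, h2⟩ := key hBm (by omega) h.le
      refine ⟨τ, (show x.count + 1 = inDeg G i - f by omega) ▸ h1, ?_⟩
      rw [← h2]
      exact if_pos h
    · obtain ⟨u, h1, h2⟩ := hx.low (hB.trans hBm) (by omega) hdeg
      refine ⟨u, h1, ?_⟩
      rw [← h2]
      exact if_neg h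

/-- The relation between the firing times and frequencies of node `i` in two successive rounds. -/
def RoundStep (G : Digraph V) (F : Finset V) (f : ℕ) (α : ℝ) (i : V) (T w T' w' : V → ℝ) : Prop :=
  ResilientStep G F f α w i (w' i) ∧
    ∃ y P, ResilientStep G F f (1 / 2) T i y ∧ T' i = y + P ∧
      ∀ lo hi, 0 < lo → (∀ j, j ∉ F → lo ≤ w j ∧ w j ≤ hi) → 1 / hi ≤ P ∧ P ≤ 1 / lo

theorem period_mem {J a b lo hi : ℝ} (hJ : |J| ≤ 1 / 4) (hlo : 0 < lo) (ha : lo ≤ a ∧ a ≤ hi)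
    (hb : lo ≤ b ∧ b ≤ hi) :
    1 / hi ≤ (1 / 2 + J) * (1 / a) + (1 / 2 - J) * (1 / b) ∧
      (1 / 2 + J) * (1 / a) + (1 / 2 - J) * (1 / b) ≤ 1 / lo := by
  obtain ⟨h1, h2⟩ := abs_le.1 hJ
  have a1 : 1 / a ≤ 1 / lo := one_div_le_one_div_of_le hlo ha.1
  have a2 : 1 / hi ≤ 1 / a := one_div_le_one_div_of_le (hlo.trans_le ha.1) ha.2
  have b1 : 1 / b ≤ 1 / lo := one_div_le_one_div_of_le hlo hb.1
  have b2 : 1 / hi ≤ 1 / b := one_div_le_one_div_of_le (hlo.trans_le hb.1) hb.2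
  constructor <;> nlinarith

theorem NodeInv.update {α : ℝ} (hx : NodeInv G F f i T w (normalNbrs G F i) B τ x) (hα : 0 ≤ α)
    (hw : ∀ j, j ∉ F → 0 < w j)
    (hlocal : IsLocalAttack G F f) (hi : i ∉ F)
    (hdeg : 2 * f + 1 ≤ inDeg G i ∨ inNbrs G i = ∅)
    (hphase : x.phase = 1 / 2) (hflag : x.flag = true) {y : Oscillator}
    (hy : x.Updates f (inDeg G i) α y) (hcount : x.count ≤ inDeg G i) {T' w' : V → ℝ}
    (hT' : lineTime y τ = T' i) (hw' : y.freq = w' i) :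
    RoundStep G F f α i T w T' w' ∧ NodeInv G F f i T' w' ∅ 0 τ y := by
  have hN := card_normalNbrs_add G F i
  have hF := hlocal i hi
  have hcnt := hx.count
  -- All normal in-neighbours are counted, so the absence of a detection bounds the number of other
  -- pulses.
  have hBm : B.card ≤ (F ∩ inNbrs G i).card := by omega
  have hwi := hw i hi
  obtain ⟨hmain, hfl, hc0, hr0, hz1, hz2⟩ := hy
  rw [if_neg (not_lt.2 hcount)] at hmain
  obtain ⟨hph, a₀, a, ha₀, ha, hsum, hfr⟩ := hmain
  have hup := hx.up_mem
  have hlow := hx.low_mem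
  have hcard : x.recv.card = x.count := by
    rw [hx.recv, hx.count, Multiset.card_add, Multiset.card_map]; rfl
  have hstep : ResilientStep G F f α w i (w' i) := by
    rw [← hw', hfr, hx.freq]
    exact resilientStep_freq hα hlocal hi hdeg hx.recv hBm (by rw [hcard]) ha₀ ha hsum
  obtain ⟨J, hJ⟩ : ∃ J, J = (x.zUp + x.zLow) / 2 := ⟨_, rfl⟩
  have hJabs : |J| ≤ 1 / 4 := by
    rw [hJ, abs_le]
    constructor <;> linarith [hup.1, hup.2, hlow.1, hlow.2]
  have hwpos : 0 < w' i := by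
    have hne : Fᶜ.Nonempty := ⟨i, by simpa using hi⟩
    obtain ⟨j, hj, hjeq⟩ := Finset.exists_mem_eq_inf' hne w
    have h1 := hstep.ge_hull (Fᶜ.inf' hne w) fun l hl => Finset.inf'_le _ (by simpa using hl)
    have h2 : Fᶜ.inf' hne w ≤ w i := Finset.inf'_le _ (by simpa using hi)
    have h3 := mul_le_mul_of_nonneg_left h2 hα
    have h4 := hw j (by simpa using hj)
    linarith
  have hTi : τ = T i + 1 / 2 * (1 / w i) := by
    have := hx.phase_of_flag hwi hflag
    rw [hphase] at this
    field_simp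
    linarith
  -- The next firing is at `T i + (1 / 2) / w i + (1 / 2 - J) / w' i`. Splitting off `T i - J / w
  -- i`, the averaged firing time, leaves a convex combination of the old and the new period.
  refine ⟨⟨hstep, T i - J / w i, (1 / 2 + J) * (1 / w i) + (1 / 2 - J) * (1 / w' i), ?_, ?_, ?_⟩, ?_⟩
  · rcases hdeg with hd | hd
    · obtain ⟨u, hu1, hu2⟩ := hx.up hBm (by omega)
      obtain ⟨v, hv1, hv2⟩ := hx.low hBm (by omega) hd
      have : T i - J / w i = (min (T i) u + max (T i) v) / 2 := by
        rw [hJ, hu2, hv2]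
        have e1 : min (T i) u = T i - max 0 (T i - u) := by
          rcases le_total (T i) u with h | h
          · rw [min_eq_left h, max_eq_left (by linarith)]; ring
          · rw [min_eq_right h, max_eq_right (by linarith)]; ring
        have e2 : max (T i) v = T i + max 0 (v - T i) := by
          rcases le_total (T i) v with h | h
          · rw [max_eq_right h, max_eq_right (by linarith)]; ring
          · rw [max_eq_left h, max_eq_left (by linarith)]; ring
        rw [e1, e2]
        field_simp
        ring
      rw [this]
      exact resilientStep_time hlocal hi hd hu1 hv1
    · obtain ⟨h1, h2⟩ := hx.isolated hd
      have : J = 0 := by rw [hJ, h1, h2]; norm_num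
      rw [this, zero_div, sub_zero]
      exact resilientStep_self hi hd T
  · rw [← hT', lineTime, hfl, if_neg (by simp), hph, hphase, hw', hTi, ← hJ]
    field_simp
    ring
  · intro lo hi' hlo h
    exact period_mem hJabs hlo (h i hi) (hstep.mem_hull hi hα h)
  · refine ⟨Finset.empty_subset _, hw', hT', ?_, by simpa using hr0, by simpa using hc0,
      fun _ => rfl, hz1 ▸ hup, hz2 ▸ hlow, fun h => hz1 ▸ hz2 ▸ hx.isolated h, ?_, ?_⟩
    · rw [hph, hphase, ← hJ]
      linarith [(abs_le.1 hJabs).1]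
    -- The stored `zUp` and `zLow` are not reset, but the conditions on them are void while the
    -- counter is `0`.
    · intro _ h
      omega
    · intro _ h1 h2
      omega

theorem NodeInv.congr_set {S' : Finset V} (hx : NodeInv G F f i T w S B τ x) (h : S = S') :
    NodeInv G F f i T w S' B τ x := h ▸ hx

end Node

/-! ### Convergence of frequencies and firing times over the rounds -/

section Rounds

variable {V : Type*} [Fintype V] [DecidableEq V] {G : Digraph V} {F : Finset V} {f : ℕ} {α : ℝ}

theorem one_div_sub_le {lo hi : ℝ} (hlo : 1 ≤ lo) (h : lo ≤ hi) : 1 / lo ≤ 1 / hi + (hi - lo) := by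
  have h1 : 0 < lo := by linarith
  have h2 : 0 < hi := by linarith
  have : 1 / lo - 1 / hi = (hi - lo) / (lo * hi) := by field_simp
  have h3 : (hi - lo) / (lo * hi) ≤ hi - lo :=
    div_le_self (by linarith) (by nlinarith)
  linarith

theorem perturbedStep_freq {T w T' w' : V → ℝ}
    (h : ∀ i, i ∉ F → RoundStep G F f α i T w T' w') : PerturbedStep G F f α 0 0 w w' :=
  fun i hi => ⟨w' i, (h i hi).1, by simp, by simp⟩

/-- All periods lie between `1 / max w` and `1 / min w`. Since inversion is `1`-Lipschitz on `[1,
∞)`, these differ by at most the spread of `w`. -/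
theorem exists_perturbedStep_time (hF : Fᶜ.Nonempty) {T w T' w' : V → ℝ}
    (h : ∀ i, i ∉ F → RoundStep G F f α i T w T' w') (hw : ∀ i, i ∉ F → 1 ≤ w i) :
    ∃ p, PerturbedStep G F f (1 / 2) p (spread F w) T T' := by
  have hlo : 1 ≤ Fᶜ.inf' hF w := by
    refine Finset.le_inf' _ _ fun i hi => hw i (by simpa using hi)
  refine ⟨1 / Fᶜ.sup' hF w, fun i hi => ?_⟩
  obtain ⟨y, P, hy, hT, hP⟩ := (h i hi).2
  obtain ⟨h1, h2⟩ := hP (Fᶜ.inf' hF w) (Fᶜ.sup' hF w) (by linarith) fun j hj =>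
    ⟨Finset.inf'_le _ (by simpa using hj), Finset.le_sup' _ (by simpa using hj)⟩
  have hle : Fᶜ.inf' hF w ≤ Fᶜ.sup' hF w :=
    (Finset.inf'_le _ (by simpa using hi : i ∈ Fᶜ)).trans (Finset.le_sup' _ (by simpa using hi))
  have h3 := one_div_sub_le hlo hle
  have h4 : spread F w = Fᶜ.sup' hF w - Fᶜ.inf' hF w := by simp [spread, hF]
  exact ⟨y, hy, by linarith, by linarith⟩

/-- The first `n` rounds obey the update rules. -/
def RoundsUpTo (G : Digraph V) (F : Finset V) (f : ℕ) (α : ℝ) (T W : ℕ → V → ℝ) (n : ℕ) : Prop :=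
  ∀ i, i ∉ F → ∀ l < n, RoundStep G F f α i (T l) (W l) (T (l + 1)) (W (l + 1))

variable {T W : ℕ → V → ℝ} {n : ℕ}

theorem RoundsUpTo.mono {m : ℕ} (h : RoundsUpTo G F f α T W n) (hm : m ≤ n) :
    RoundsUpTo G F f α T W m := fun i hi l hl => h i hi l (hl.trans_le hm)

theorem RoundsUpTo.freq_mem (h : RoundsUpTo G F f α T W n) (hα : 0 ≤ α) {lo hi : ℝ}
    (h0 : ∀ i, i ∉ F → lo ≤ W 0 i ∧ W 0 i ≤ hi) : ∀ i, i ∉ F → lo ≤ W n i ∧ W n i ≤ hi := by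
  induction n with
  | zero => exact h0
  | succ n ih =>
    intro i hi
    exact (h i hi n (by omega)).1.mem_hull hi hα (ih (h.mono (by omega)))

theorem RoundsUpTo.freq_spread_contract (h : RoundsUpTo G F f α T W n) (hα : 0 < α) (hα1 : α ≤ 1)
    (hF : Fᶜ.Nonempty) (hlocal : IsLocalAttack G F f) (hrobust : IsRobust G (2 * f + 1)) {l : ℕ}
    (hl : l + Fᶜ.card ≤ n) :
    spread F (W (l + Fᶜ.card)) ≤ (1 - α ^ Fᶜ.card / 2) * spread F (W l) := by
  have := spread_contract hα hα1 hF hlocal hrobust (x := fun m => W (l + m)) (p := fun _ => 0)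
    (η := fun _ => 0) (fun _ _ => le_rfl) fun m hm =>
      perturbedStep_freq fun i hi => h i hi (l + m) (by omega)
  simpa using this

theorem one_sub_pow_half_mem (hα : 0 < α) (hα1 : α ≤ 1) (R : ℕ) :
    0 ≤ 1 - α ^ R / 2 ∧ 1 - α ^ R / 2 < 1 := by
  have h1 := pow_pos hα R
  have h2 := pow_le_one₀ (n := R) hα.le hα1
  constructor <;> linarith

theorem RoundsUpTo.sum_freq_spread_le (h : RoundsUpTo G F f α T W n) (hα : 0 < α) (hα1 : α ≤ 1)
    (hF : Fᶜ.Nonempty) (hlocal : IsLocalAttack G F f) (hrobust : IsRobust G (2 * f + 1)) {δ : ℝ}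
    (h0 : ∀ i, i ∉ F → 1 ≤ W 0 i ∧ W 0 i ≤ 1 + δ) :
    ∑ l ∈ Finset.range n, spread F (W l) ≤ 2 * Fᶜ.card / α ^ Fᶜ.card * δ := by
  have hδ : 0 ≤ δ := by
    obtain ⟨i, hi⟩ := id hF
    linarith [h0 i (by simpa using hi)]
  have h1 := sum_le_of_contract (n := n) (R := Fᶜ.card) (S := fun l => spread F (W l))
    (E := fun _ => 0) (C := δ) (one_sub_pow_half_mem hα hα1 Fᶜ.card).1 hδ
    (fun l => spread_nonneg _) (fun _ => le_rfl)
    (fun l hl => spread_le hF fun i j hi hj => by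
      have h2 := (h.mono hl.le).freq_mem hα.le h0
      linarith [(h2 i hi).2, (h2 j hj).1])
    (fun l hl => by
      have := h.freq_spread_contract hα hα1 hF hlocal hrobust hl.le
      linarith)
  have h2 := pow_pos hα Fᶜ.card
  rw [div_mul_eq_mul_div, le_div_iff₀ h2]
  simp only [sub_sub_cancel, Finset.sum_const_zero, add_zero] at h1
  linarith

theorem RoundsUpTo.time_spread_le (h : RoundsUpTo G F f α T W n) (hα : 0 ≤ α)
    (hF : Fᶜ.Nonempty) (h0 : ∀ i, i ∉ F → 1 ≤ W 0 i) :
    spread F (T n) ≤ spread F (T 0) + ∑ l ∈ Finset.range n, spread F (W l) := by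
  induction n with
  | zero => simp
  | succ n ih =>
    obtain ⟨lo, hi, h1, -⟩ := exists_hull_spread hF (W 0)
    obtain ⟨p, hp⟩ := exists_perturbedStep_time hF (fun i hi => h i hi n (by omega))
      (fun i hi => ((h.mono (by omega)).freq_mem hα fun j hj => ⟨h0 j hj, (h1 j hj).2⟩) i hi |>.1)
    have h2 := hp.spread_le hF (by norm_num)
    have h3 := ih (h.mono (by omega))
    rw [Finset.sum_range_succ]
    linarith

theorem tendsto_freq_spread (h : ∀ n, RoundsUpTo G F f α T W n) (hα : 0 < α) (hα1 : α ≤ 1)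
    (hF : Fᶜ.Nonempty) (hlocal : IsLocalAttack G F f) (hrobust : IsRobust G (2 * f + 1)) {δ : ℝ}
    (h0 : ∀ i, i ∉ F → 1 ≤ W 0 i ∧ W 0 i ≤ 1 + δ) :
    Filter.Tendsto (fun n => spread F (W n)) Filter.atTop (nhds 0) :=
  (summable_of_sum_range_le (fun n => spread_nonneg (W n)) fun n =>
    (h n).sum_freq_spread_le hα hα1 hF hlocal hrobust h0).tendsto_atTop_zero

/-- The spread of the times contracts over `R` rounds up to errors that are sums of frequency
spreads. These errors are summable, hence so are the spreads. -/
theorem tendsto_time_spread (h : ∀ n, RoundsUpTo G F f α T W n) (hα : 0 < α) (hα1 : α ≤ 1)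
    (hF : Fᶜ.Nonempty) (hlocal : IsLocalAttack G F f) (hrobust : IsRobust G (2 * f + 1)) {δ : ℝ}
    (h0 : ∀ i, i ∉ F → 1 ≤ W 0 i ∧ W 0 i ≤ 1 + δ) :
    Filter.Tendsto (fun n => spread F (T n)) Filter.atTop (nhds 0) := by
  have hsum := fun n => (h n).sum_freq_spread_le hα hα1 hF hlocal hrobust h0
  set H := 2 * Fᶜ.card / α ^ Fᶜ.card * δ
  have hp : ∀ n, ∃ p, PerturbedStep G F f (1 / 2) p (spread F (W n)) (T n) (T (n + 1)) := fun n =>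
    exists_perturbedStep_time hF (fun i hi => h (n + 1) i hi n (by omega))
      fun i hi => ((h n).freq_mem hα.le h0 i hi).1
  choose p hp using hp
  have hq := one_sub_pow_half_mem (show (0 : ℝ) < 1 / 2 by norm_num) (by norm_num) Fᶜ.card
  have hbound : ∀ n, spread F (T n) ≤ spread F (T 0) + H := fun n =>
    ((h n).time_spread_le hα.le hF fun i hi => (h0 i hi).1).trans (by linarith [hsum n])
  have hE : ∀ n, ∑ l ∈ Finset.range n, ∑ m ∈ Finset.range Fᶜ.card, spread F (W (l + m)) ≤
      Fᶜ.card * H := by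
    intro n
    -- Each of the `R` shifted sums of frequency spreads is bounded by `H`.
    rw [Finset.sum_comm]
    have : ∀ m ∈ Finset.range Fᶜ.card, ∑ l ∈ Finset.range n, spread F (W (l + m)) ≤ H := by
      intro m _
      have h1 := Finset.sum_range_add (fun l => spread F (W l)) m n
      have h2 := Finset.sum_nonneg fun l (_ : l ∈ Finset.range m) => spread_nonneg (F := F) (W l)
      have h3 := hsum (m + n)
      simp only [add_comm _ m]
      linarith
    simpa using Finset.sum_le_card_nsmul _ _ _ this
  refine Summable.tendsto_atTop_zero (summable_of_sum_range_le (fun n => spread_nonneg (T n))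
    (c := (Fᶜ.card * (spread F (T 0) + H) + Fᶜ.card * H) / (1 - (1 - (1 / 2) ^ Fᶜ.card / 2)))
    fun n => ?_)
  rw [le_div_iff₀ (by linarith [hq.2])]
  have h1 := sum_le_of_contract (n := n) (R := Fᶜ.card) (S := fun l => spread F (T l))
    (E := fun l => ∑ m ∈ Finset.range Fᶜ.card, spread F (W (l + m))) (C := spread F (T 0) + H)
    hq.1 ((spread_nonneg _).trans (hbound 0)) (fun l => spread_nonneg _)
    (fun l => Finset.sum_nonneg fun m _ => spread_nonneg _) (fun l _ => hbound l)
    (fun l _ => spread_contract (by norm_num) (by norm_num) hF hlocal hrobust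
      (x := fun m => T (l + m)) (p := fun m => p (l + m)) (η := fun m => spread F (W (l + m)))
      (fun _ _ => spread_nonneg _) fun m _ => hp (l + m))
  linarith [hE n]

end Rounds

/-! ### The network invariant and its preservation by each event -/

section Run

variable {V : Type*} [Fintype V] [DecidableEq V] {G : Digraph V} {F : Finset V} {f : ℕ} {α : ℝ}

/-- As long as all rounds obey the update rules, the frequencies stay in `[1, 1 + δ]` and the
firing times of a round differ by at most `D`. -/
def Controlled (G : Digraph V) (F : Finset V) (f : ℕ) (α : ℝ) (T W : ℕ → V → ℝ) (δ D : ℝ) : Prop :=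
  ∀ n, RoundsUpTo G F f α T W n →
    (∀ i, i ∉ F → 1 ≤ W n i ∧ W n i ≤ 1 + δ) ∧ ∀ i j, i ∉ F → j ∉ F → T n i - T n j ≤ D

/-- The normal in-neighbours of `i` whose pulses of the current round of `i` have been sent, when
`st j` is the number of firings and updates of node `j` so far. -/
def sent (G : Digraph V) (F : Finset V) (st : V → ℕ) (i : V) : Finset V :=
  (normalNbrs G F i).filter fun j => 2 * (st i / 2) < st j

/-- The state `x` of the network at time `τ`, when each node `i` has fired or updated `st i` times,
and `T n`, `W n` are the firing times and frequencies of round `n`. -/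
structure RunInv (G : Digraph V) (F : Finset V) (f : ℕ) (α : ℝ) (T W : ℕ → V → ℝ) (st : V → ℕ)
    (τ : ℝ) (x : V → Oscillator) : Prop where
  flag : ∀ i, i ∉ F → ((x i).flag = true ↔ st i % 2 = 1)
  stage_le : ∀ i j, i ∉ F → j ∉ F → st i ≤ st j + 1
  node : ∀ i, i ∉ F → ∃ B,
    NodeInv G F f i (T (st i / 2)) (W (st i / 2)) (sent G F st i) B τ (x i)
  past : ∀ i, i ∉ F → ∀ n, 2 * n + 1 ≤ st i → T n i ≤ τ
  rounds : ∀ i, i ∉ F → ∀ n, 2 * (n + 1) ≤ st i →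
    RoundStep G F f α i (T n) (W n) (T (n + 1)) (W (n + 1))

variable {T W : ℕ → V → ℝ} {δ D : ℝ} {st : V → ℕ} {τ : ℝ} {x : V → Oscillator}

namespace RunInv

theorem roundsUpTo (h : RunInv G F f α T W st τ x) {n : ℕ} (hn : ∀ i, i ∉ F → 2 * n ≤ st i) :
    RoundsUpTo G F f α T W n := fun i hi l hl =>
  h.rounds i hi l (by have := hn i hi; omega)

/-- A node may enter round `m + 1` before the others, when `Controlled` is available only for round
`m`; its own last step then keeps it in the hull. -/
theorem freq_mem (h : RunInv G F f α T W st τ x) (hα : 0 ≤ α) (hc : Controlled G F f α T W δ D)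
    {i : V} (hi : i ∉ F) : 1 ≤ W (st i / 2) i ∧ W (st i / 2) i ≤ 1 + δ := by
  rcases Nat.eq_zero_or_pos (st i / 2) with h0 | h0
  · rw [h0]
    exact (hc 0 fun _ _ l hl => absurd hl (Nat.not_lt_zero l)).1 i hi
  · obtain ⟨m, hm⟩ := Nat.exists_eq_succ_of_ne_zero h0.ne'
    rw [hm]
    have h1 := hc m (h.roundsUpTo fun j hj => by
      have := h.stage_le i j hi hj
      omega)
    exact (h.rounds i hi m (by omega)).1.mem_hull hi hα h1.1

theorem flow (h : RunInv G F f α T W st τ x) (hα : 0 ≤ α) (hc : Controlled G F f α T W δ D)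
    {s : ℝ} (hs : 0 ≤ s) : RunInv G F f α T W st (τ + s) fun i => (x i).flow s where
  flag := h.flag
  stage_le := h.stage_le
  node i hi := by
    obtain ⟨B, hB⟩ := h.node i hi
    exact ⟨B, hB.flow (by linarith [h.freq_mem hα hc hi]) hs⟩
  past i hi n hn := (h.past i hi n hn).trans (by linarith)
  rounds := h.rounds

/-- The phase of a node that has fired in its current round. -/
theorem phase_odd (h : RunInv G F f α T W st τ x) (hα : 0 ≤ α) (hc : Controlled G F f α T W δ D)
    {i : V} (hi : i ∉ F) {n : ℕ} (hn : st i = 2 * n + 1) :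
    (x i).phase = W n i * (τ - T n i) := by
  obtain ⟨B, hB⟩ := h.node i hi
  have hw := h.freq_mem hα hc hi
  rw [show st i / 2 = n by omega] at hB hw
  exact hB.phase_of_flag (by linarith) ((h.flag i hi).2 (by omega))

/-- The phase of a node that has not yet fired in its current round. -/
theorem phase_even (h : RunInv G F f α T W st τ x) (hα : 0 ≤ α) (hc : Controlled G F f α T W δ D)
    {i : V} (hi : i ∉ F) {n : ℕ} (hn : st i = 2 * n) :
    (x i).phase = 1 - W n i * (T n i - τ) := by
  obtain ⟨B, hB⟩ := h.node i hi
  have hw := h.freq_mem hα hc hi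
  rw [show st i / 2 = n by omega] at hB hw
  refine hB.phase_of_not_flag (by linarith) ?_
  have := (h.flag i hi).not.2 (by omega)
  simpa using this

theorem phase_nonneg (h : RunInv G F f α T W st τ x) {i : V} (hi : i ∉ F) : 0 ≤ (x i).phase := by
  obtain ⟨B, hB⟩ := h.node i hi
  exact hB.nonneg

theorem freq_eq (h : RunInv G F f α T W st τ x) {i : V} (hi : i ∉ F) {n : ℕ} (hn : st i / 2 = n) :
    (x i).freq = W n i := by
  obtain ⟨B, hB⟩ := h.node i hi
  exact hn ▸ hB.freq

theorem le_of_even (h : RunInv G F f α T W st τ x) (hα : 0 ≤ α) (hc : Controlled G F f α T W δ D)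
    {i : V} (hi : i ∉ F) {n : ℕ} (hn : st i = 2 * n) (hphase : (x i).phase ≤ 1) : τ ≤ T n i := by
  have h1 := h.phase_even hα hc hi hn
  have h2 := h.freq_mem hα hc hi
  rw [show st i / 2 = n by omega] at h2
  by_contra hcon
  nlinarith

theorem le_of_odd (h : RunInv G F f α T W st τ x) (hα : 0 ≤ α) (hc : Controlled G F f α T W δ D)
    {i : V} (hi : i ∉ F) {n : ℕ} (hn : st i = 2 * n + 1) (hphase : (x i).phase ≤ 1 / 2) :
    τ ≤ T n i + 1 / 2 := by
  have h1 := h.phase_odd hα hc hi hn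
  have h2 := h.freq_mem hα hc hi
  rw [show st i / 2 = n by omega] at h2
  by_contra hcon
  nlinarith

theorem spread_bounds (hc : Controlled G F f α T W δ D) {i : V} (hi : i ∉ F) :
    0 ≤ δ ∧ 0 ≤ D := by
  have h0 := hc 0 fun _ _ l hl => absurd hl (Nat.not_lt_zero l)
  exact ⟨by linarith [h0.1 i hi], by linarith [h0.2 i i hi hi]⟩

theorem mul_sub_lt (hc : Controlled G F f α T W δ D) (hD : D + δ < 1 / 2) {i l l' : V} (hi : i ∉ F)
    (hl : l ∉ F) (hl' : l' ∉ F) {n : ℕ} (hr : RoundsUpTo G F f α T W n) {w : ℝ} (hw : 0 ≤ w)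
    (hw' : w ≤ 1 + δ) : w * (T n l - T n l') < 1 / 2 := by
  obtain ⟨h1, h2⟩ := spread_bounds hc hi
  have h3 := (hc n hr).2 l l' hl hl'
  have h4 : w * (T n l - T n l') ≤ w * D := mul_le_mul_of_nonneg_left h3 hw
  have h5 : w * D ≤ (1 + δ) * D := mul_le_mul_of_nonneg_right hw' h2
  nlinarith

/-- When a node fires, no node is still in the previous round. -/
theorem stage_ge_of_fire (h : RunInv G F f α T W st τ x) (hα : 0 ≤ α)
    (hc : Controlled G F f α T W δ D) (hD : D + δ < 1 / 2)
    (hphase' : ∀ i, i ∉ F → (x i).flag = true → (x i).phase ≤ 1 / 2) {j : V} (hj : j ∉ F)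
    (hfire : (x j).phase = 1) {n : ℕ} (hn : st j = 2 * n) {i : V} (hi : i ∉ F) : 2 * n ≤ st i := by
  by_contra hcon
  obtain ⟨m, rfl⟩ : ∃ m, n = m + 1 := Nat.exists_eq_succ_of_ne_zero (by omega)
  have hsi : st i = 2 * m + 1 := by
    have := h.stage_le j i hj hi
    omega
  have hr : RoundsUpTo G F f α T W m := h.roundsUpTo fun l hl => by
    have := h.stage_le j l hj hl
    omega
  obtain ⟨y, P, hy, hT, hP⟩ := (h.rounds j hj m (by omega)).2
  obtain ⟨hδ, -⟩ := spread_bounds hc hj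
  obtain ⟨hP1, -⟩ := hP 1 (1 + δ) one_pos (hc m hr).1
  have hP2 : 1 - δ ≤ 1 / (1 + δ) := by
    rw [le_div_iff₀ (by linarith)]
    nlinarith
  have hle := h.le_of_odd hα hc hi hsi (hphase' i hi ((h.flag i hi).2 (by omega)))
  have hfreq := h.freq_mem hα hc hj
  rw [show st j / 2 = m + 1 by omega] at hfreq
  have hτ : T (m + 1) j = τ := by
    -- The contradiction: `j` fires at `y + P ≥ T m i - D + 1 - δ`, but a node `i` that still has to
    -- act forces the time to be at most `T m i + 1 / 2`.
    have h1 := h.phase_even hα hc hj hn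
    rw [hfire] at h1
    have h2 : W (m + 1) j * (T (m + 1) j - τ) = 0 := by linarith
    rcases mul_eq_zero.1 h2 with h3 | h3 <;> linarith
  have hyl := hy.ge_hull (T m i - D) fun l hl => by linarith [(hc m hr).2 i l hi hl]
  have := (hc m hr).2 i j hi hj
  linarith

/-- When a node updates, all nodes have fired in its current round. -/
theorem stage_ge_of_update (h : RunInv G F f α T W st τ x) (hα : 0 ≤ α)
    (hc : Controlled G F f α T W δ D) (hD : D + δ < 1 / 2)
    (hphase : ∀ i, i ∉ F → (x i).phase ≤ 1) {i : V} (hi : i ∉ F)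
    (hup : (x i).phase = 1 / 2) {n : ℕ} (hn : st i = 2 * n + 1) {l : V} (hl : l ∉ F) :
    2 * n + 1 ≤ st l := by
  by_contra hcon
  have hge : ∀ j, j ∉ F → 2 * n ≤ st j := fun j hj => by
    have := h.stage_le i j hi hj
    omega
  have hsl : st l = 2 * n := by
    have := hge l hl
    omega
  have h1 := h.le_of_even hα hc hl hsl (hphase l hl)
  have h2 := h.phase_odd hα hc hi hn
  have h3 := h.freq_mem hα hc hi
  rw [show st i / 2 = n by omega] at h3
  have h4 := mul_sub_lt hc hD hi hl hi (h.roundsUpTo hge) (by linarith) h3.2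
  have h5 : W n i * (τ - T n i) ≤ W n i * (T n l - T n i) :=
    mul_le_mul_of_nonneg_left (by linarith) (by linarith)
  linarith

theorem mem_sent (h : RunInv G F f α T W st τ x) (hα : 0 ≤ α) (hc : Controlled G F f α T W δ D)
    (hphase : ∀ i, i ∉ F → (x i).phase ≤ 1) {i : V}
    (hge : ∀ j, j ∉ F → 2 * (st i / 2) ≤ st j) :
    ∀ l ∈ normalNbrs G F i, T (st i / 2) l < τ → l ∈ sent G F st i := by
  intro l hl hlt
  refine Finset.mem_filter.2 ⟨hl, ?_⟩
  have hlF := (Finset.mem_sdiff.1 hl).2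
  have := hge l hlF
  by_contra hcon
  have := h.le_of_even hα hc hlF (n := st i / 2) (by omega) (hphase l hlF)
  linarith

/-- The sender has already fired in the round of `i`, and no stage is more than one behind another.
-/
theorem stage_ge_of_sent (h : RunInv G F f α T W st τ x) {i l : V} (hl : l ∈ sent G F st i) :
    ∀ j, j ∉ F → 2 * (st i / 2) ≤ st j := by
  intro j hj
  obtain ⟨h1, h2⟩ := Finset.mem_filter.1 hl
  have := h.stage_le l j (Finset.mem_sdiff.1 h1).2 hj
  omega

theorem attack (h : RunInv G F f α T W st τ x) (hα : 0 ≤ α) (hc : Controlled G F f α T W δ D)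
    (hD : D + δ < 1 / 2) (hlocal : IsLocalAttack G F f)
    (hdeg : ∀ i, i ∉ F → 2 * f + 1 ≤ inDeg G i ∨ inNbrs G i = ∅)
    (hphase : ∀ i, i ∉ F → (x i).phase ≤ 1)
    (hphase' : ∀ i, i ∉ F → (x i).flag = true → (x i).phase ≤ 1 / 2) {x' : V → Oscillator}
    (hx' : ∀ i, i ∉ F → x' i = x i ∨ (∃ j ∈ F, j ∈ inNbrs G i) ∧
      ∃ c, x' i = (x i).receive f (inDeg G i) c) : RunInv G F f α T W st τ x' where
  flag i hi := by
    rw [← h.flag i hi]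
    rcases hx' i hi with h1 | ⟨_, c, h1⟩ <;> rw [h1] <;> rfl
  stage_le := h.stage_le
  node i hi := by
    obtain ⟨B, hB⟩ := h.node i hi
    rcases hx' i hi with h1 | ⟨⟨j, hjF, hj⟩, c, h1⟩
    · exact ⟨B, h1 ▸ hB⟩
    · have hw := h.freq_mem hα hc hi
      refine ⟨c ::ₘ B, h1 ▸ hB.receive (by linarith) hlocal hi ?_ (hphase i hi) (hphase' i hi)
        hB.subset (Multiset.add_cons _ _ _) ?_ ?_ ?_⟩
      · exact (hdeg i hi).resolve_right fun h => by simp [h] at hj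
      · simp
      · intro h2
        have : j ∈ F ∩ inNbrs G i := Finset.mem_inter.2 ⟨hjF, hj⟩
        simp [h2] at this
      · rintro ⟨l, hl⟩
        have hge := h.stage_ge_of_sent hl
        refine ⟨h.mem_sent hα hc hphase hge, fun k hk => ?_, fun l l' hl hl' =>
          mul_sub_lt hc hD hi hl hl' (h.roundsUpTo hge) (by linarith) hw.2⟩
        obtain ⟨hk1, hk2⟩ := Finset.mem_filter.1 hk
        exact h.past k (Finset.mem_sdiff.1 hk1).2 _ hk2
  past := h.past
  rounds := h.rounds

theorem fire (h : RunInv G F f α T W st τ x) (hα : 0 ≤ α) (hc : Controlled G F f α T W δ D)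
    (hD : D + δ < 1 / 2) (hlocal : IsLocalAttack G F f)
    (hdeg : ∀ i, i ∉ F → 2 * f + 1 ≤ inDeg G i ∨ inNbrs G i = ∅)
    (hphase : ∀ i, i ∉ F → (x i).phase ≤ 1)
    (hphase' : ∀ i, i ∉ F → (x i).flag = true → (x i).phase ≤ 1 / 2) {j : V} (hj : j ∉ F)
    (hfire : (x j).phase = 1) {x' : V → Oscillator} {st' : V → ℕ}
    (hst : st' j = st j + 1) (hst' : ∀ i, i ≠ j → st' i = st i)
    (hx' : ∀ i, i ∉ F → (j ∈ inNbrs G i ∧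
        x' i = (if i = j then (x i).fire else x i).receive f (inDeg G i) (x j).freq) ∨
      (j ∉ inNbrs G i ∧ x' i = if i = j then (x i).fire else x i)) :
    RunInv G F f α T W st' τ x' := by
  have hjflag : (x j).flag = false := by
    by_contra hcon
    have := hphase' j hj (by simpa using hcon)
    linarith
  obtain ⟨n, hn⟩ : ∃ n, st j = 2 * n := by
    have := (h.flag j hj).not.1 (by simp [hjflag])
    exact ⟨st j / 2, by omega⟩
  have hge : ∀ i, i ∉ F → 2 * n ≤ st i := fun i hi =>
    h.stage_ge_of_fire hα hc hD hphase' hj hfire hn hi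
  have hle : ∀ i, i ∉ F → st i ≤ 2 * n + 1 := fun i hi => hn ▸ h.stage_le i j hi hj
  have hdiv : ∀ i, i ∉ F → st i / 2 = n := fun i hi => by
    have h1 := hge i hi
    have h2 := hle i hi
    omega
  have hdiv' : ∀ i, i ∉ F → st' i / 2 = n := fun i hi => by
    by_cases hij : i = j
    · subst hij; omega
    · rw [hst' i hij, hdiv i hi]
  have hTj : T n j = τ := by
    have h1 := h.phase_even hα hc hj hn
    have h2 := h.freq_mem hα hc hj
    rw [hdiv j hj] at h2
    rw [hfire] at h1
    have h3 : W n j * (T n j - τ) = 0 := by linarith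
    rcases mul_eq_zero.1 h3 with h4 | h4 <;> linarith
  have hpast : ∀ i, i ∉ F → ∀ m, 2 * m + 1 ≤ st' i → T m i ≤ τ := by
    intro i hi m hm
    by_cases hij : i = j
    · subst hij
      rcases (show m = n ∨ 2 * m + 1 ≤ st i by omega) with rfl | h1
      · exact hTj.le
      · exact h.past i hi m h1
    · exact h.past i hi m (hst' i hij ▸ hm)
  refine ⟨fun i hi => ?_, fun i l hi hl => ?_, fun i hi => ?_, hpast, fun i hi m hm => ?_⟩
  · have : (x' i).flag = (if i = j then (x i).fire else x i).flag := by
      rcases hx' i hi with ⟨_, h1⟩ | ⟨_, h1⟩ <;> rw [h1] <;> rfl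
    rw [this]
    by_cases hij : i = j
    · subst hij
      simp only [if_true, hst, hn]
      simp [Oscillator.fire]
    · rw [if_neg hij, hst' i hij]
      exact h.flag i hi
  · have h1 := hge l hl
    have h2 := hle i hi
    have h3 : st l ≤ st' l := by
      by_cases hlj : l = j
      · subst hlj; omega
      · exact (hst' l hlj).ge
    have h4 : st' i ≤ 2 * n + 1 := by
      by_cases hij : i = j
      · subst hij; omega
      · rw [hst' i hij]; exact h2
    omega
  · obtain ⟨B, hB⟩ := h.node i hi
    have hw := h.freq_mem hα hc hi
    refine ⟨B, ?_⟩
    rw [hdiv' i hi]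
    rw [hdiv i hi] at hB hw
    -- With a self-loop, the firing node receives its own pulse after its reset.
    have hB1 : NodeInv G F f i (T n) (W n) (sent G F st i) B τ
        (if i = j then (x i).fire else x i) := by
      by_cases hij : i = j
      · subst hij
        rw [if_pos rfl]
        exact hB.fire hjflag hfire
      · rwa [if_neg hij]
    have hsent : ∀ l ∈ normalNbrs G F i, l ≠ j → (l ∈ sent G F st' i ↔ l ∈ sent G F st i) := by
      intro l hl hlj
      simp only [sent, Finset.mem_filter, hdiv i hi, hdiv' i hi, hst' l hlj]
    rcases hx' i hi with ⟨hadj, h1⟩ | ⟨hadj, h1⟩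
    · have hjN : j ∈ normalNbrs G F i := Finset.mem_sdiff.2 ⟨hadj, hj⟩
      have hjS : j ∉ sent G F st i := fun hmem => by
        have := (Finset.mem_filter.1 hmem).2
        rw [hdiv i hi] at this
        omega
      have hS' : sent G F st' i = insert j (sent G F st i) := by
        ext l
        rw [Finset.mem_insert]
        by_cases hlj : l = j
        · subst hlj
          simp only [true_or, iff_true]
          refine Finset.mem_filter.2 ⟨hjN, ?_⟩
          rw [hdiv' i hi]
          omega
        · simp only [hlj, false_or]
          by_cases hl : l ∈ normalNbrs G F i
          · exact hsent l hl hlj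
          · simp [sent, hl]
      rw [h1]
      refine hB1.receive (by linarith) hlocal hi ?_ ?_ ?_ (Finset.filter_subset _ _) ?_ le_rfl
        hB.no_attack fun _ => ⟨?_, ?_, ?_⟩
      · exact (hdeg i hi).resolve_right fun h => by simp [h] at hadj
      · by_cases hij : i = j
        · simp [hij, Oscillator.fire]
        · simpa [hij] using hphase i hi
      · by_cases hij : i = j
        · simp [hij, Oscillator.fire]
        · simpa [hij] using hphase' i hi
      · rw [hS', Finset.insert_val_of_notMem hjS, Multiset.map_cons, Multiset.cons_add,
          h.freq_eq hj (hdiv j hj)]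
      · have := h.mem_sent hα hc hphase (i := i) (by rw [hdiv i hi]; exact hge)
        rwa [hdiv i hi] at this
      · intro k hk
        obtain ⟨hk1, hk2⟩ := Finset.mem_filter.1 hk
        rw [hdiv' i hi] at hk2
        exact hpast k (Finset.mem_sdiff.1 hk1).2 _ hk2
      · exact fun l l' hl hl' =>
          mul_sub_lt hc hD hi hl hl' (h.roundsUpTo hge) (by linarith) hw.2
    · rw [h1]
      refine hB1.congr_set ?_
      ext l
      by_cases hl : l ∈ normalNbrs G F i
      · refine (hsent l hl fun hlj => hadj ?_).symm
        exact hlj ▸ (Finset.mem_sdiff.1 hl).1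
      · simp [sent, hl]
  · refine h.rounds i hi m ?_
    by_cases hij : i = j
    · subst hij; omega
    · exact hst' i hij ▸ hm

theorem update (h : RunInv G F f α T W st τ x) (hα : 0 ≤ α) (hc : Controlled G F f α T W δ D)
    (hD : D + δ < 1 / 2) (hlocal : IsLocalAttack G F f)
    (hdeg : ∀ i, i ∉ F → 2 * f + 1 ≤ inDeg G i ∨ inNbrs G i = ∅)
    (hphase : ∀ i, i ∉ F → (x i).phase ≤ 1) {j : V} (hj : j ∉ F)
    (hup : (x j).phase = 1 / 2) (hflag : (x j).flag = true) {x' : V → Oscillator} {st' : V → ℕ}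
    (hst : st' j = st j + 1) (hst' : ∀ i, i ≠ j → st' i = st i)
    (hcount : (x j).count ≤ inDeg G j)
    (hx' : (x j).Updates f (inDeg G j) α (x' j)) (hxne : ∀ i, i ∉ F → i ≠ j → x' i = x i)
    (hT : T (st' j / 2) j = lineTime (x' j) τ) (hW : W (st' j / 2) j = (x' j).freq) :
    RunInv G F f α T W st' τ x' := by
  obtain ⟨n, hn⟩ : ∃ n, st j = 2 * n + 1 := by
    have := (h.flag j hj).1 hflag
    exact ⟨st j / 2, by omega⟩
  have hge : ∀ i, i ∉ F → 2 * n + 1 ≤ st i := fun i hi =>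
    h.stage_ge_of_update hα hc hD hphase hj hup hn hi
  have hle : ∀ i, i ∉ F → st i ≤ 2 * n + 2 := fun i hi => by
    have := h.stage_le i j hi hj
    omega
  have hge' : ∀ i, i ∉ F → 2 * n + 1 ≤ st' i := fun i hi => by
    by_cases hij : i = j
    · subst hij; omega
    · rw [hst' i hij]; exact hge i hi
  have hle' : ∀ i, i ∉ F → st' i ≤ 2 * n + 2 := fun i hi => by
    by_cases hij : i = j
    · subst hij; omega
    · rw [hst' i hij]; exact hle i hi
  obtain ⟨B, hB⟩ := h.node j hj
  have hsj : sent G F st j = normalNbrs G F j := Finset.filter_true_of_mem fun l hl => by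
    have := hge l (Finset.mem_sdiff.1 hl).2
    omega
  have hr := h.roundsUpTo (n := n) fun i hi => by
    have := hge i hi
    omega
  rw [hsj, show st j / 2 = n by omega] at hB
  rw [show st' j / 2 = n + 1 by omega] at hT hW
  obtain ⟨hround, hnode⟩ := hB.update hα (fun i hi => by linarith [((hc n hr).1 i hi).1]) hlocal hj
    (hdeg j hj) hup hflag hx' hcount hT.symm hW.symm
  refine ⟨fun i hi => ?_, fun i l hi hl => ?_, fun i hi => ?_, fun i hi m hm => ?_,
    fun i hi m hm => ?_⟩
  · by_cases hij : i = j
    · subst hij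
      have hfl : (x' i).flag = false := hx'.2.1
      rw [hfl]
      simp
      omega
    · rw [hxne i hi hij, hst' i hij]
      exact h.flag i hi
  · have h1 := hge' l hl
    have h2 := hle' i hi
    omega
  · by_cases hij : i = j
    · subst hij
      refine ⟨0, ?_⟩
      -- Nobody has fired in round `n + 1` yet, since no stage exceeds `2 * n + 2`.
      have hs : sent G F st' i = ∅ := Finset.filter_false_of_mem fun l hl => by
        have := hle' l (Finset.mem_sdiff.1 hl).2
        omega
      rw [hs, show st' i / 2 = n + 1 by omega]
      exact hnode
    · obtain ⟨B', hB'⟩ := h.node i hi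
      refine ⟨B', ?_⟩
      rw [hst' i hij, hxne i hi hij]
      refine hB'.congr_set (Finset.filter_congr fun l hl => ?_)
      have h1 := hge i hi
      have h2 := hle i hi
      rw [hst' i hij]
      by_cases hlj : l = j
      · subst hlj; omega
      · rw [hst' l hlj]
  · by_cases hij : i = j
    · subst hij
      exact h.past i hi m (by omega)
    · exact h.past i hi m (hst' i hij ▸ hm)
  · by_cases hij : i = j
    · subst hij
      rcases (show m = n ∨ 2 * (m + 1) ≤ st i by omega) with rfl | h1
      · exact hround
      · exact h.rounds i hi m h1
    · exact h.rounds i hi m (hst' i hij ▸ hm)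

/-- A counter above the in-degree is caused by a misbehaving in-neighbour. -/
theorem exists_attacker (h : RunInv G F f α T W st τ x) {i : V} (hi : i ∉ F)
    (hcount : inDeg G i < (x i).count) : ∃ j ∈ F, j ∈ inNbrs G i := by
  obtain ⟨B, hB⟩ := h.node i hi
  have h1 := Finset.card_le_card hB.subset
  have h2 := card_normalNbrs_add G F i
  have h3 := hB.count
  have h4 : F ∩ inNbrs G i ≠ ∅ := fun h0 => by
    have h5 := hB.no_attack h0
    simp only [h5, h0, Finset.card_empty, Multiset.card_zero] at h2 h3
    omega
  obtain ⟨j, hj⟩ := Finset.nonempty_iff_ne_empty.2 h4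
  exact ⟨j, (Finset.mem_inter.1 hj).1, (Finset.mem_inter.1 hj).2⟩

end RunInv

end Run

/-! ### From rounds to phases at arbitrary times -/

section Phases

variable {V : Type*} [Fintype V] [DecidableEq V] {G : Digraph V} {F : Finset V} {f : ℕ} {α : ℝ}
variable {T W : ℕ → V → ℝ} {δ D : ℝ} {st : V → ℕ} {τ : ℝ} {x : V → Oscillator}

theorem abs_one_sub_mul_le {w P lo d : ℝ} (hlo : 1 ≤ lo) (hw : lo ≤ w ∧ w ≤ lo + d)
    (hP : 1 / (lo + d) ≤ P ∧ P ≤ 1 / lo) : |1 - w * P| ≤ d := by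
  have hd : 0 ≤ d := by linarith
  have h0 : 0 < lo + d := by linarith
  have h1 : w * P ≤ (lo + d) * (1 / lo) :=
    mul_le_mul hw.2 hP.2 ((one_div_pos.2 h0).le.trans hP.1) h0.le
  have h2 : lo * (1 / (lo + d)) ≤ w * P :=
    mul_le_mul hw.1 hP.1 (one_div_pos.2 h0).le (by linarith)
  have h3 : (lo + d) * (1 / lo) ≤ 1 + d := by
    rw [mul_one_div, div_le_iff₀ (by linarith)]
    nlinarith
  have h4 : 1 - d ≤ lo * (1 / (lo + d)) := by
    rw [mul_one_div, le_div_iff₀ h0]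
    nlinarith
  rw [abs_le]
  constructor <;> linarith

/-- Up to integers, the phase of each node is that of a rotation by its frequency that passes
through `0` close to the firing times of round `n`. -/
theorem RunInv.exists_rotation (h : RunInv G F f α T W st τ x) (hα : 0 ≤ α)
    (hc : Controlled G F f α T W δ D)
    (hphase : ∀ i, i ∉ F → (x i).phase ≤ 1) {n : ℕ}
    (hn : ∀ l, l ∉ F → 2 * n ≤ st l ∧ st l ≤ 2 * n + 2) {lo d a D' : ℝ} (hlo : 1 ≤ lo)
    (hd : d ≤ 1) (hw : ∀ i, i ∉ F → lo ≤ W n i ∧ W n i ≤ lo + d)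
    (hT : ∀ i, i ∉ F → a ≤ T n i ∧ T n i ≤ a + D') {i : V} (hi : i ∉ F) :
    ∃ (m : ℤ) (z r : ℝ), (x i).phase + m = (x i).freq * (τ - z) + r ∧
      (lo ≤ (x i).freq ∧ (x i).freq ≤ lo + d) ∧ (a ≤ z ∧ z ≤ a + D') ∧ |τ - z| ≤ 2 ∧ |r| ≤ d := by
  have h0 := h.phase_nonneg hi
  have h1 := hphase i hi
  have hwi := hw i hi
  obtain ⟨hn1, hn2⟩ := hn i hi
  have hd0 : 0 ≤ d := by linarith
  rcases (show st i = 2 * n ∨ st i = 2 * n + 1 ∨ st i = 2 * (n + 1) by omega) with hs | hs | hs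
  · have hfr := h.freq_eq hi (show st i / 2 = n by omega)
    have hp := h.phase_even hα hc hi hs
    refine ⟨-1, T n i, 0, ?_, hfr ▸ hwi, hT i hi, ?_, by simpa using hd0⟩
    · rw [hfr, hp]; push_cast; ring
    · rw [abs_le]
      constructor <;> nlinarith
  · have hfr := h.freq_eq hi (show st i / 2 = n by omega)
    have hp := h.phase_odd hα hc hi hs
    refine ⟨0, T n i, 0, ?_, hfr ▸ hwi, hT i hi, ?_, by simpa using hd0⟩
    · rw [hfr, hp]; push_cast; ring
    · rw [abs_le]
      constructor <;> nlinarith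
  · have hfr := h.freq_eq hi (show st i / 2 = n + 1 by omega)
    have hp := h.phase_even hα hc hi hs
    obtain ⟨hW, y, P, hy, hTy, hP⟩ := h.rounds i hi n hs.ge
    have hwi' := hW.mem_hull hi hα hw
    have hr := abs_one_sub_mul_le hlo hwi' (hP lo (lo + d) (by linarith) hw)
    -- A node already in round `n + 1` is traced back to its averaged firing time `y` of round `n`;
    -- one turn then misses the integer `1` by `1 - W (n + 1) i * P`.
    have heq : (x i).phase = W (n + 1) i * (τ - y) + (1 - W (n + 1) i * P) := by
      rw [hp, hTy]; ring
    refine ⟨0, y, 1 - W (n + 1) i * P, ?_, hfr ▸ hwi', hy.mem_hull hi (by norm_num) hT, ?_, hr⟩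
    · rw [hfr, ← heq]; simp
    · obtain ⟨h2, h3⟩ := abs_le.1 hr
      rw [abs_le]
      constructor <;> nlinarith

/-- The constant `4` collects `2 * d` from the frequency difference acting for a time at most `2`,
and `d` from each remainder. -/
theorem abs_rotation_sub_le {w w' z z' r r' τ lo d a D' Ω : ℝ} (hw : lo ≤ w ∧ w ≤ lo + d)
    (hw' : lo ≤ w' ∧ w' ≤ lo + d) (hlo : 0 ≤ lo) (hΩ : lo + d ≤ Ω) (hz : a ≤ z ∧ z ≤ a + D')
    (hz' : a ≤ z' ∧ z' ≤ a + D') (hτ' : |τ - z'| ≤ 2) (hr : |r| ≤ d) (hr' : |r'| ≤ d) :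
    |(w * (τ - z) + r) - (w' * (τ - z') + r')| ≤ Ω * D' + 4 * d := by
  have h1 : |w * (z' - z)| ≤ Ω * D' := by
    rw [abs_mul]
    refine mul_le_mul ?_ ?_ (abs_nonneg _) (by linarith)
    · rw [abs_of_nonneg (by linarith)]; linarith
    · rw [abs_le]; constructor <;> linarith
  have h2 : |(w - w') * (τ - z')| ≤ d * 2 := by
    rw [abs_mul]
    refine mul_le_mul ?_ hτ' (abs_nonneg _) (by linarith)
    rw [abs_le]; constructor <;> linarith
  have h3 : (w * (τ - z) + r) - (w' * (τ - z') + r') =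
      w * (z' - z) + (w - w') * (τ - z') + r - r' := by ring
  rw [h3]
  rw [abs_le] at *
  constructor <;> linarith

end Phases

/-! ### Arcs and distances on the circle -/

section Circle

variable {V : Type*}

theorem arcLength_le [Fintype V] [DecidableEq V] {F : Finset V} (hF : Fᶜ.Nonempty) {φ θ : V → ℝ}
    {X : ℝ} (hX : X < 1) (hθ : ∀ i, i ∉ F → ∃ m : ℤ, θ i = φ i + m)
    (h : ∀ i j, i ∉ F → j ∉ F → |θ i - θ j| ≤ X) : arcLength F φ ≤ X := by
  obtain ⟨j, hj, hmin⟩ := Finset.exists_min_image Fᶜ θ hF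
  have hj' : j ∉ F := by simpa using hj
  refine csInf_le ⟨0, fun L hL => hL.1⟩ ⟨(abs_nonneg _).trans (h j j hj' hj'), θ j, fun i hi => ?_⟩
  obtain ⟨m, hm⟩ := hθ i hi
  have h1 := (abs_le.1 (h i j hi hj')).2
  have h2 := hmin i (by simpa using hi)
  have h3 : φ i - θ j = (θ i - θ j) - m := by rw [hm]; ring
  rw [h3, Int.fract_sub_intCast, Int.fract_eq_self.2 ⟨by linarith, by linarith⟩]
  exact h1

/-- On a half-circle, a containing arc shorter than `φ i - φ j` would make the two integer parts
relative to its start differ by an integer strictly between `0` and `1`. -/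
theorem sub_le_arcLength {F : Finset V} {φ : V → ℝ} (hφ : ∀ i, i ∉ F → φ i ∈ Set.Ico 0 (1 / 2))
    {i j : V} (hi : i ∉ F) (hj : j ∉ F) : φ i - φ j ≤ arcLength F φ := by
  have hi' := hφ i hi
  have hj' := hφ j hj
  refine le_csInf ⟨1, zero_le_one, 0, fun k _ => (Int.fract_lt_one _).le⟩ ?_
  rintro L ⟨hL, a, h⟩
  by_contra hcon
  have h1 := h i hi
  have h2 := h j hj
  have h3 := Int.fract_nonneg (φ i - a)
  have h4 := Int.fract_nonneg (φ j - a)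
  have e1 := Int.self_sub_floor (φ i - a)
  have e2 := Int.self_sub_floor (φ j - a)
  have h5 : ((⌊φ i - a⌋ - ⌊φ j - a⌋ : ℤ) : ℝ) < 1 := by
    push_cast
    linarith [hi'.1, hi'.2, hj'.1, hj'.2]
  have h6 : (0 : ℝ) < ((⌊φ i - a⌋ - ⌊φ j - a⌋ : ℤ) : ℝ) := by
    push_cast
    linarith [hi'.1, hi'.2, hj'.1, hj'.2]
  have h7 : (⌊φ i - a⌋ - ⌊φ j - a⌋ : ℤ) < 1 := by exact_mod_cast h5
  have h8 : (0 : ℤ) < ⌊φ i - a⌋ - ⌊φ j - a⌋ := by exact_mod_cast h6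
  omega

theorem dist_coe_le_of_eq_add_int {φ φ' θ θ' : ℝ} (h : ∃ m : ℤ, θ = φ + m)
    (h' : ∃ m : ℤ, θ' = φ' + m) :
    dist (φ : UnitAddCircle) (φ' : UnitAddCircle) ≤ |θ - θ'| := by
  obtain ⟨m, rfl⟩ := h
  obtain ⟨m', rfl⟩ := h'
  rw [dist_eq_norm, ← AddCircle.coe_sub, UnitAddCircle.norm_eq]
  refine (round_le (φ - φ') (m' - m)).trans (le_of_eq ?_)
  congr 1
  push_cast
  ring

end Circle

/-! ### Late hybrid times have late event indices -/

section LateTimes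

variable {t : ℕ → ℝ}

theorem eventually_lateTimes (ht : Monotone t) (K : ℕ) :
    ∀ᶠ p in lateTimes t, p ∈ hybridTimes t ∧ K ≤ p.1 := by
  refine Filter.eventually_inf_principal.2 ?_
  filter_upwards [Filter.preimage_mem_comap (Filter.Ioi_mem_atTop (t K))] with p hp hp'
  refine ⟨hp', ?_⟩
  by_contra hcon
  have h1 := ht (show p.1 + 1 ≤ K by omega)
  exact absurd (hp'.2.trans h1) (not_le.2 hp)

end LateTimes

/-! ### Degree bounds from robustness -/

section Degree

variable {V : Type*} [Fintype V] [DecidableEq V] {G : Digraph V} {F : Finset V} {f : ℕ}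

/-- Test robustness on `{i}` and its complement. A node of the complement has at most the
in-neighbour `i` outside it, which suffices only for `f = 0`. -/
theorem IsRobust.inNbrs_card (hrobust : IsRobust G (2 * f + 1)) (hV : 1 < Fintype.card V) (i : V) :
    2 * f + 1 ≤ (inNbrs G i \ {i}).card ∨ f = 0 := by
  have hne : ({i} : Finset V)ᶜ.Nonempty := by
    rw [← Finset.card_pos, Finset.card_compl, Finset.card_singleton]
    omega
  have hd : Disjoint ({i} : Finset V) {i}ᶜ := disjoint_compl_right
  rcases hrobust {i} {i}ᶜ (Finset.singleton_nonempty i) hne hd (ssubset_univ_of_disjoint hd hne)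
    (ssubset_univ_of_disjoint hd.symm (Finset.singleton_nonempty i)) with ⟨j, hj, h⟩ | ⟨j, hj, h⟩
  · rw [Finset.mem_singleton] at hj
    exact Or.inl (hj ▸ h)
  · right
    have h1 : inNbrs G j \ {i}ᶜ ⊆ {i} := fun l hl => by
      simpa using (Finset.mem_sdiff.1 hl).2
    have := Finset.card_le_card h1
    rw [Finset.card_singleton] at this
    omega

theorem IsRobust.le_inDeg (hrobust : IsRobust G (2 * f + 1)) (hV : 1 < Fintype.card V) (i : V) :
    2 * f + 1 ≤ inDeg G i ∨ inNbrs G i = ∅ := by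
  rcases hrobust.inNbrs_card hV i with h | h
  · exact Or.inl (h.trans (Finset.card_le_card Finset.sdiff_subset))
  · subst h
    rcases (inNbrs G i).eq_empty_or_nonempty with h | h
    · exact Or.inr h
    · exact Or.inl (Finset.card_pos.2 h)

/-- If there is only one normal node, no misbehaving node can reach it. -/
theorem IsRobust.not_mem_inNbrs (hrobust : IsRobust G (2 * f + 1)) (hlocal : IsLocalAttack G F f)
    {i j : V} (hi : i ∉ F) (hone : ∀ l, l ∉ F → l = i) (hj : j ∈ F) : j ∉ inNbrs G i := by
  intro hmem
  have hV : 1 < Fintype.card V :=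
    Fintype.one_lt_card_iff.2 ⟨i, j, fun h => hi (h ▸ hj)⟩
  have h1 := hlocal i hi
  have h2 : inNbrs G i \ {i} ⊆ F ∩ inNbrs G i := fun l hl => by
    obtain ⟨h3, h4⟩ := Finset.mem_sdiff.1 hl
    refine Finset.mem_inter.2 ⟨?_, h3⟩
    by_contra hcon
    exact h4 (Finset.mem_singleton.2 (hone l hcon))
  have h3 := Finset.card_le_card h2
  rcases hrobust.inNbrs_card hV i with h | h
  · omega
  · have : j ∈ F ∩ inNbrs G i := Finset.mem_inter.2 ⟨hj, hmem⟩
    have := Finset.card_pos.2 ⟨j, this⟩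
    omega

theorem mem_inNbrs {U : Type*} [Fintype U] {G : Digraph U} {i j : U} : j ∈ inNbrs G i ↔ G.Adj i j := by simp [inNbrs]

end Degree

/-! ### The invariant along an execution -/

section Execution

variable {V : Type*}

open Classical in
/-- The number of firings and updates of node `i` among the first `k` events. -/
def stage (e : ℕ → Event V) (i : V) : ℕ → ℕ
  | 0 => 0
  | k + 1 => stage e i k + if e k = .fire i ∨ e k = .update i then 1 else 0

theorem stage_succ_of_mem {e : ℕ → Event V} {i : V} {k : ℕ} (h : e k = .fire i ∨ e k = .update i) :
    stage e i (k + 1) = stage e i k + 1 := by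
  simp [stage, h]

theorem stage_succ_of_notMem {e : ℕ → Event V} {i : V} {k : ℕ}
    (h : ¬ (e k = .fire i ∨ e k = .update i)) : stage e i (k + 1) = stage e i k := by
  simp [stage, h]

theorem stage_mono (e : ℕ → Event V) (i : V) : Monotone (stage e i) :=
  monotone_nat_of_le_succ fun k => by simp [stage]

/-- The index of the first event after which node `i` is in round `n`. -/
def roundStart (e : ℕ → Event V) (i : V) (n : ℕ) : ℕ := sInf {k | stage e i k = 2 * n}

theorem roundStart_zero (e : ℕ → Event V) (i : V) : roundStart e i 0 = 0 :=
  Nat.sInf_eq_zero.2 (Or.inl rfl)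

theorem roundStart_eq {e : ℕ → Event V} {i : V} {n k : ℕ} (h : stage e i (k + 1) = 2 * n)
    (h' : stage e i k < 2 * n) : roundStart e i n = k + 1 := by
  refine IsLeast.csInf_eq ⟨h, fun l hl => ?_⟩
  by_contra hcon
  have := stage_mono e i (show l ≤ k by omega)
  rw [Set.mem_ofPred_eq] at hl
  omega

/-- The time of the firing of node `i` in round `n`. -/
def roundTime (t : ℕ → ℝ) (e : ℕ → Event V) (s : ℕ → V → Oscillator) (n : ℕ) (i : V) : ℝ :=
  lineTime (s (roundStart e i n) i) (t (roundStart e i n))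

/-- The frequency of node `i` in round `n`. -/
def roundFreq (e : ℕ → Event V) (s : ℕ → V → Oscillator) (n : ℕ) (i : V) : ℝ :=
  (s (roundStart e i n) i).freq

variable [Fintype V] [DecidableEq V] {G : Digraph V} {F : Finset V} {f : ℕ} {α : ℝ}
  {t : ℕ → ℝ} {e : ℕ → Event V} {s : ℕ → V → Oscillator} {δ D : ℝ}

/-- The invariant after the first `k` events. -/
def RunInvAt (G : Digraph V) (F : Finset V) (f : ℕ) (α : ℝ) (t : ℕ → ℝ) (e : ℕ → Event V)
    (s : ℕ → V → Oscillator) (k : ℕ) : Prop :=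
  RunInv G F f α (roundTime t e s) (roundFreq e s) (fun i => stage e i k) (t k) (s k)

theorem IsExecution.runInvAt_zero (hrun : IsExecution G F f α t e s)
    (hphase : ∀ i, i ∉ F → 0 ≤ (s 0 i).phase) : RunInvAt G F f α t e s 0 where
  flag i hi := by simp [(hrun.fresh i hi).1, stage]
  stage_le i j _ _ := by simp [stage]
  node i hi := by
    obtain ⟨h1, h2, h3, h4, h5⟩ := hrun.fresh i hi
    have hsent : sent G F (fun i => stage e i 0) i = ∅ :=
      Finset.filter_false_of_mem fun l _ => by simp [stage]
    refine ⟨0, ?_⟩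
    rw [hsent]
    refine ⟨Finset.empty_subset _, ?_, ?_, hphase i hi, by simpa using h3, by simpa using h2,
      fun _ => rfl, by rw [h4]; norm_num, by rw [h5]; norm_num, fun _ => ⟨h4, h5⟩,
      fun _ h => ?_, fun _ h h' => ?_⟩
    · simp [roundFreq, roundStart_zero, stage]
    · simp [roundTime, roundStart_zero, stage]
    · omega
    · omega
  past i _ n hn := by simp [stage] at hn
  rounds i _ n hn := by simp [stage] at hn

theorem IsExecution.phase_le_one (hrun : IsExecution G F f α t e s) {k : ℕ} {i : V} (hi : i ∉ F)
    (hw : 0 ≤ (s k i).freq) {h : ℝ} (hh : h ≤ t (k + 1) - t k) :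
    ((s k i).flow h).phase ≤ 1 ∧
      (((s k i).flow h).flag = true → ((s k i).flow h).phase ≤ 1 / 2) := by
  have h1 : ((s k i).flow h).phase ≤ ((s k i).flow (t (k + 1) - t k)).phase :=
    add_le_add le_rfl (mul_le_mul_of_nonneg_left hh hw)
  exact ⟨h1.trans (hrun.phase_le k i hi), fun hfl => h1.trans (hrun.phase_le_of_flag k i hi hfl)⟩

theorem RunInvAt.flow {k : ℕ} (h : RunInvAt G F f α t e s k) (hα : 0 ≤ α)
    (hc : Controlled G F f α (roundTime t e s) (roundFreq e s) δ D) {τ : ℝ} (hτ : t k ≤ τ) :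
    RunInv G F f α (roundTime t e s) (roundFreq e s) (fun i => stage e i k) τ
      fun i => (s k i).flow (τ - t k) := by
  have := RunInv.flow h hα hc (s := τ - t k) (by linarith)
  rwa [add_sub_cancel] at this

theorem RunInvAt.freq_nonneg {k : ℕ} (h : RunInvAt G F f α t e s k) (hα : 0 ≤ α)
    (hc : Controlled G F f α (roundTime t e s) (roundFreq e s) δ D) {i : V} (hi : i ∉ F) :
    0 ≤ (s k i).freq := by
  have h1 := RunInv.freq_eq h hi rfl
  have h2 := RunInv.freq_mem h hα hc hi
  linarith

theorem IsExecution.runInvAt_succ (hrun : IsExecution G F f α t e s) (hα : 0 ≤ α)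
    (hc : Controlled G F f α (roundTime t e s) (roundFreq e s) δ D) (hD : D + δ < 1 / 2)
    (hlocal : IsLocalAttack G F f)
    (hdeg : ∀ i, i ∉ F → 2 * f + 1 ≤ inDeg G i ∨ inNbrs G i = ∅) {k : ℕ}
    (h : RunInvAt G F f α t e s k) (hdet : ∀ i, ¬ DetectsAt G F e s k i) :
    RunInvAt G F f α t e s (k + 1) := by
  have hflow := h.flow hα hc (hrun.time_mono (Nat.le_succ k))
  have hph := fun i (hi : i ∉ F) =>
    hrun.phase_le_one (k := k) hi (h.freq_nonneg hα hc hi) (le_refl (t (k + 1) - t k))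
  have hstep := hrun.step k
  rcases he : e k with j | j | ⟨j, msg⟩
  · simp only [Step, he] at hstep
    obtain ⟨hj, hfire, hq⟩ := hstep
    refine hflow.fire hα hc hD hlocal hdeg (fun i hi => (hph i hi).1) (fun i hi => (hph i hi).2)
      hj hfire (stage_succ_of_mem (Or.inl he)) (fun i hi => stage_succ_of_notMem ?_)
      fun i hi => ?_
    · simp only [he, Event.fire.injEq, reduceCtorEq, or_false]
      exact fun h => hi h.symm
    · by_cases hadj : G.Adj i j
      · exact Or.inl ⟨mem_inNbrs.2 hadj, by rw [hq i hi, if_pos hadj]⟩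
      · exact Or.inr ⟨mt mem_inNbrs.1 hadj, by rw [hq i hi, if_neg hadj]⟩
  · simp only [Step, he] at hstep
    obtain ⟨hj, hphase, hflag, hup, hq⟩ := hstep
    have hst := stage_succ_of_mem (e := e) (i := j) (k := k) (Or.inr he)
    have hodd := (hflow.flag j hj).1 hflag
    -- The action raises an odd stage to an even one, so the new round begins at this event and its
    -- data are read off from the state just after it.
    have hstart : roundStart e j (stage e j (k + 1) / 2) = k + 1 :=
      roundStart_eq (by omega) (by omega)
    refine hflow.update hα hc hD hlocal hdeg (fun i hi => (hph i hi).1) hj hphase hflag hst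
      (fun i hi => stage_succ_of_notMem ?_) ?_ hup hq ?_ ?_
    · simp only [he, Event.update.injEq, reduceCtorEq, false_or]
      exact fun h => hi h.symm
    · by_contra hcon
      exact hdet j ⟨hj, he, not_le.1 hcon⟩
    · simp only [roundTime, hstart]
    · simp only [roundFreq, hstart]
  · simp only [Step, he] at hstep
    obtain ⟨hj, hq⟩ := hstep
    have hst : (fun i => stage e i (k + 1)) = fun i => stage e i k := by
      funext i
      exact stage_succ_of_notMem (by simp [he])
    rw [RunInvAt, hst]
    refine hflow.attack hα hc hD hlocal hdeg (fun i hi => (hph i hi).1)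
      (fun i hi => (hph i hi).2) fun i hi => ?_
    have h1 := hq i hi
    rcases hm : msg i with _ | w
    · simp only [hm] at h1
      exact Or.inl h1
    · simp only [hm] at h1
      by_cases hadj : G.Adj i j
      · rw [if_pos hadj] at h1
        exact Or.inr ⟨⟨j, hj, mem_inNbrs.2 hadj⟩, w, h1⟩
      · rw [if_neg hadj] at h1
        exact Or.inl h1

theorem IsExecution.runInvAt (hrun : IsExecution G F f α t e s) (hα : 0 ≤ α)
    (hc : Controlled G F f α (roundTime t e s) (roundFreq e s) δ D) (hD : D + δ < 1 / 2)
    (hlocal : IsLocalAttack G F f)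
    (hdeg : ∀ i, i ∉ F → 2 * f + 1 ≤ inDeg G i ∨ inNbrs G i = ∅)
    (hphase : ∀ i, i ∉ F → 0 ≤ (s 0 i).phase) (k : ℕ)
    (hdet : ∀ l < k, ∀ i, ¬ DetectsAt G F e s l i) : RunInvAt G F f α t e s k := by
  induction k with
  | zero => exact hrun.runInvAt_zero hphase
  | succ k ih =>
    exact hrun.runInvAt_succ hα hc hD hlocal hdeg (ih fun l hl => hdet l (by omega))
      (hdet k (by omega))

/-- Without detections, every normal node passes through infinitely many rounds. -/
theorem IsExecution.exists_le_stage (hrun : IsExecution G F f α t e s) (hα : 0 ≤ α)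
    (hc : Controlled G F f α (roundTime t e s) (roundFreq e s) δ D)
    (hinv : ∀ k, RunInvAt G F f α t e s k) {i : V} (hi : i ∉ F) (M : ℕ) :
    ∃ K, M ≤ stage e i K := by
  induction M with
  | zero => exact ⟨0, Nat.zero_le _⟩
  | succ M ih =>
    obtain ⟨K, hK⟩ := ih
    by_contra! hcon
    have hst : ∀ k, K ≤ k → stage e i k = M := fun k hk => by
      have h1 := stage_mono e i hk
      have h2 := hcon k
      omega
    -- A node stuck at one stage would have to fire or act within bounded time, yet event times are
    -- unbounded.
    have hbound : ∀ k, K ≤ k → t k ≤ roundTime t e s (M / 2) i + 1 / 2 := by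
      intro k hk
      have hp := hrun.phase_le_one hi ((hinv k).freq_nonneg hα hc hi)
        (sub_nonneg.2 (hrun.time_mono (Nat.le_succ k)))
      have hz : (s k i).flow 0 = s k i := by simp [Oscillator.flow]
      rw [hz] at hp
      rcases Nat.even_or_odd' M with ⟨m, hm | hm⟩
      · have := RunInv.le_of_even (hinv k) hα hc hi (n := m) (by rw [hst k hk, hm]) hp.1
        rw [show M / 2 = m by omega]
        linarith
      · have := RunInv.le_of_odd (hinv k) hα hc hi (n := m) (by rw [hst k hk, hm])
          (hp.2 ((RunInv.flag (hinv k) i hi).2 (by rw [hst k hk]; omega)))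
        rw [show M / 2 = m by omega]
        linarith
    obtain ⟨k, hk1, hk2⟩ := ((hrun.time_tendsto.eventually_gt_atTop
      (roundTime t e s (M / 2) i + 1 / 2)).and (Filter.eventually_ge_atTop K)).exists
    exact absurd (hbound k hk2) (not_le.2 hk1)

theorem IsExecution.eventually_le_stage (hrun : IsExecution G F f α t e s) (hα : 0 ≤ α)
    (hc : Controlled G F f α (roundTime t e s) (roundFreq e s) δ D)
    (hinv : ∀ k, RunInvAt G F f α t e s k) (M : ℕ) :
    ∃ K, ∀ k, K ≤ k → ∀ i, i ∉ F → M ≤ stage e i k := by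
  have h : ∀ i, ∃ K, i ∉ F → M ≤ stage e i K := fun i => by
    by_cases hi : i ∈ F
    · exact ⟨0, fun h => absurd hi h⟩
    · obtain ⟨K, hK⟩ := hrun.exists_le_stage hα hc hinv hi M
      exact ⟨K, fun _ => hK⟩
  choose K hK using h
  exact ⟨Finset.univ.sup K, fun k hk i hi => (hK i hi).trans
    (stage_mono e i ((Finset.le_sup (Finset.mem_univ i)).trans hk))⟩

/-- At any time, up to integers, the phases are close to each other if the current round has
similar firing times and frequencies. -/
theorem RunInvAt.exists_unrolled (hrun : IsExecution G F f α t e s) (hα : 0 ≤ α)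
    (hF : Fᶜ.Nonempty)
    (hc : Controlled G F f α (roundTime t e s) (roundFreq e s) δ D) (hδ1 : δ ≤ 1) {p : ℕ × ℝ}
    (hp : p ∈ hybridTimes t) (hinv : RunInvAt G F f α t e s p.1) {M : ℕ}
    (hM : ∀ i, i ∉ F → 2 * M ≤ stage e i p.1) :
    ∃ n, M ≤ n ∧ RoundsUpTo G F f α (roundTime t e s) (roundFreq e s) n ∧
      (∀ i j, i ∉ F → j ∉ F → |freqAt s p i - freqAt s p j| ≤ spread F (roundFreq e s n)) ∧
      ∃ θ : V → ℝ, (∀ i, i ∉ F → ∃ m : ℤ, θ i = phaseAt t s p i + m) ∧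
        ∀ i j, i ∉ F → j ∉ F → |θ i - θ j| ≤
          (1 + δ) * spread F (roundTime t e s n) + 4 * spread F (roundFreq e s n) := by
  have hflow := hinv.flow hα hc hp.1
  have hph := fun i (hi : i ∉ F) =>
    (hrun.phase_le_one (k := p.1) hi (hinv.freq_nonneg hα hc hi)
      (sub_le_sub_right hp.2 (t p.1))).1
  obtain ⟨j, hj, hmin⟩ := Finset.exists_min_image Fᶜ (fun i => stage e i p.1) hF
  have hj' : j ∉ F := by simpa using hj
  -- The round of the slowest node: every other node is in it or waits for its firing of the next
  -- one.
  obtain ⟨n, hn⟩ : ∃ n, n = stage e j p.1 / 2 := ⟨_, rfl⟩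
  have hst : ∀ i, i ∉ F → 2 * n ≤ stage e i p.1 ∧ stage e i p.1 ≤ 2 * n + 2 := fun i hi => by
    have h1 := hmin i (by simpa using hi)
    have h2 := RunInv.stage_le hinv i j hi hj'
    omega
  have hr := hflow.roundsUpTo fun i hi => (hst i hi).1
  have hW := (hc n hr).1
  obtain ⟨i1, i2, hi1, hi2, hW'⟩ := exists_spread_eq hF (roundFreq e s n)
  obtain ⟨a, b, hab, hT⟩ := exists_hull_spread hF (roundTime t e s n)
  have hWle : ∀ i, i ∉ F → roundFreq e s n i2 ≤ roundFreq e s n i ∧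
      roundFreq e s n i ≤ roundFreq e s n i2 + spread F (roundFreq e s n) := fun i hi => by
    have h1 := sub_le_spread hi hi2 (roundFreq e s n)
    have h2 := sub_le_spread hi1 hi (roundFreq e s n)
    constructor <;> linarith
  have hTle : ∀ i, i ∉ F → a ≤ roundTime t e s n i ∧
      roundTime t e s n i ≤ a + spread F (roundTime t e s n) := fun i hi => by
    have := hab i hi
    constructor <;> linarith
  have hrot := fun i (hi : i ∉ F) => hflow.exists_rotation hα hc hph hst (hW i2 hi2).1
    (by linarith [(hW i1 hi1).2, (hW i2 hi2).1]) hWle hTle hi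
  refine ⟨n, ?_, hr, fun i j hi hj => ?_, ?_⟩
  · have := hM j hj'
    omega
  · obtain ⟨_, _, _, _, h1, _⟩ := hrot i hi
    obtain ⟨_, _, _, _, h2, _⟩ := hrot j hj
    rw [freqAt, freqAt, abs_le]
    simp only [Oscillator.flow] at h1 h2
    constructor <;> linarith
  · choose! m hrot using hrot
    refine ⟨fun i => phaseAt t s p i + m i, fun i _ => ⟨m i, rfl⟩, fun i j hi hj => ?_⟩
    obtain ⟨z, r, h1, h2, h3, h4, h5⟩ := hrot i hi
    obtain ⟨z', r', h1', h2', h3', h4', h5'⟩ := hrot j hj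
    change |(((s p.1 i).flow (p.2 - t p.1)).phase + m i) -
      (((s p.1 j).flow (p.2 - t p.1)).phase + m j)| ≤ _
    rw [h1, h1']
    exact abs_rotation_sub_le h2 h2' (by linarith [(hW i2 hi2).1])
      (by linarith [(hW i1 hi1).2]) h3 h3' h4' h5 h5'

end Execution

/-! ### Assembly: constants, the single-node case, the theorem -/

section Main

variable {V : Type*} [Fintype V] [DecidableEq V] {G : Digraph V} {F : Finset V} {f : ℕ} {α : ℝ}
  {t : ℕ → ℝ} {e : ℕ → Event V} {s : ℕ → V → Oscillator} {δ D : ℝ}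

theorem resilientSync_of_runInvAt (hrun : IsExecution G F f α t e s) (hα : 0 < α) (hα1 : α ≤ 1)
    (hF : Fᶜ.Nonempty) (hlocal : IsLocalAttack G F f) (hrobust : IsRobust G (2 * f + 1))
    (hc : Controlled G F f α (roundTime t e s) (roundFreq e s) δ D)
    (hD : (1 + δ) * D + 4 * δ < 1 / 2) (hδ1 : δ ≤ 1) (hinv : ∀ k, RunInvAt G F f α t e s k) :
    ResilientSync F δ t s := by
  have hδ : 0 ≤ δ := by
    obtain ⟨i, hi⟩ := id hF
    exact (RunInv.spread_bounds hc (by simpa using hi)).1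
  have hrounds : ∀ n, RoundsUpTo G F f α (roundTime t e s) (roundFreq e s) n := fun n => by
    obtain ⟨K, hK⟩ := hrun.eventually_le_stage hα.le hc hinv (2 * n)
    exact RunInv.roundsUpTo (hinv K) (hK K le_rfl)
  have hfreq := tendsto_freq_spread hrounds hα hα1 hF hlocal hrobust (hc 0 (hrounds 0)).1
  have htime := tendsto_time_spread hrounds hα hα1 hF hlocal hrobust (hc 0 (hrounds 0)).1
  -- Passes from statements about late rounds to statements about late hybrid times.
  have hlate : ∀ q : ℕ → Prop, (∀ᶠ n in Filter.atTop, q n) →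
      ∀ᶠ p in lateTimes t, p ∈ hybridTimes t ∧ ∃ M, (∀ n, M ≤ n → q n) ∧
        ∀ i, i ∉ F → 2 * M ≤ stage e i p.1 := by
    intro q hq
    obtain ⟨M, hM⟩ := Filter.eventually_atTop.1 hq
    obtain ⟨K, hK⟩ := hrun.eventually_le_stage hα.le hc hinv (2 * M)
    filter_upwards [eventually_lateTimes hrun.time_mono K] with p hp
    exact ⟨hp.1, M, hM, hK p.1 hp.2⟩
  refine ⟨fun p hp i hi => ?_, fun p hp => ?_, fun i j hi hj => ?_, fun i j hi hj => ?_⟩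
  · rw [freqAt, RunInv.freq_eq (hinv p.1) hi rfl]
    exact RunInv.freq_mem (hinv p.1) hα.le hc hi
  · obtain ⟨n, -, hr, -, θ, hθ, h⟩ := RunInvAt.exists_unrolled hrun hα.le hF hc hδ1 hp (hinv p.1)
      (M := 0) fun i _ => Nat.zero_le _
    have hcn := hc n hr
    have h1 : spread F (roundTime t e s n) ≤ D := spread_le hF hcn.2
    have h2 : spread F (roundFreq e s n) ≤ δ := spread_le hF fun i j hi hj => by
      linarith [hcn.1 i hi, hcn.1 j hj]
    have h3 : (1 + δ) * spread F (roundTime t e s n) ≤ (1 + δ) * D :=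
      mul_le_mul_of_nonneg_left h1 (by linarith)
    refine (arcLength_le hF (by linarith) hθ h).trans_lt (by linarith)
  · refine Metric.tendsto_nhds.2 fun ε hε => ?_
    have hlim : Filter.Tendsto (fun n => (1 + δ) * spread F (roundTime t e s n)
        + 4 * spread F (roundFreq e s n)) Filter.atTop (nhds 0) := by
      simpa using (htime.const_mul (1 + δ)).add (hfreq.const_mul 4)
    filter_upwards [hlate _ (hlim.eventually_lt_const hε)] with p ⟨hp, M, hq, hM⟩
    obtain ⟨n, hn, -, -, θ, hθ, h⟩ := RunInvAt.exists_unrolled hrun hα.le hF hc hδ1 hp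
      (hinv p.1) hM
    rw [Real.dist_eq, sub_zero, abs_of_nonneg dist_nonneg]
    exact (dist_coe_le_of_eq_add_int (hθ i hi) (hθ j hj)).trans_lt
      ((h i j hi hj).trans_lt (hq n hn))
  · refine Metric.tendsto_nhds.2 fun ε hε => ?_
    filter_upwards [hlate _ (hfreq.eventually_lt_const hε)] with p ⟨hp, M, hq, hM⟩
    obtain ⟨n, hn, -, h, -⟩ := RunInvAt.exists_unrolled hrun hα.le hF hc hδ1 hp (hinv p.1) hM
    rw [Real.dist_eq, sub_zero, abs_abs]
    exact (h i j hi hj).trans_lt (hq n hn)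

/-- Slack in the initial condition: the sum of frequency spreads costs `2 * R / α ^ R`, the initial
firing times cost `1`, and the remaining `11` covers the phase estimates. -/
theorem two_mul_div_pow_add_le {N R : ℕ} (hα : 0 < α) (hα1 : α ≤ 1) (hR : 2 ≤ R) (hN : R ≤ N) :
    2 * R / α ^ R + 12 ≤ 4 * (N : ℝ) * (R : ℝ) / α ^ (2 * N * R) := by
  have h0 := pow_pos hα R
  have h1 : α ^ (2 * N * R) ≤ α ^ R :=
    pow_le_pow_of_le_one hα.le hα1 (Nat.le_mul_of_pos_left R (by omega))
  have h2 := pow_le_one₀ (n := R) hα.le hα1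
  have hR' : (2 : ℝ) ≤ R := by exact_mod_cast hR
  have hN' : (2 : ℝ) ≤ N := by exact_mod_cast hR.trans hN
  calc 2 * R / α ^ R + 12 ≤ 2 * R / α ^ R + 6 * R / α ^ R := by
        gcongr
        rw [le_div_iff₀ h0]
        nlinarith
    _ = 8 * R / α ^ R := by ring
    _ ≤ 4 * N * R / α ^ R := by
        gcongr
        nlinarith
    _ ≤ 4 * N * R / α ^ (2 * N * R) := by gcongr

theorem controlled_of_initial (hα : 0 < α) (hα1 : α ≤ 1) (hF : Fᶜ.Nonempty)
    (hlocal : IsLocalAttack G F f) (hrobust : IsRobust G (2 * f + 1))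
    (hflag : ∀ i, i ∉ F → (s 0 i).IsFresh) (htime : t 0 = 0)
    (hphase : ∀ i, i ∉ F → (s 0 i).phase ∈ Set.Ico 0 (1 / 2))
    (hfreq : ∀ i, i ∉ F → (s 0 i).freq ∈ Set.Icc 1 (1 + δ)) :
    Controlled G F f α (roundTime t e s) (roundFreq e s) δ
      (arcLength F (fun i => (s 0 i).phase) + δ + 2 * Fᶜ.card / α ^ Fᶜ.card * δ) := by
  intro n hr
  have hW0 : ∀ i, i ∉ F → 1 ≤ roundFreq e s 0 i ∧ roundFreq e s 0 i ≤ 1 + δ := fun i hi => by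
    rw [roundFreq, roundStart_zero]
    exact hfreq i hi
  refine ⟨hr.freq_mem hα.le hW0, fun i j hi hj => ?_⟩
  have h1 := sub_le_spread hi hj (roundTime t e s n)
  have h2 := hr.time_spread_le hα.le hF fun i hi => (hW0 i hi).1
  have h3 := hr.sum_freq_spread_le hα hα1 hF hlocal hrobust hW0
  have h4 : spread F (roundTime t e s 0) ≤ arcLength F (fun i => (s 0 i).phase) + δ := by
    refine spread_le hF fun i j hi hj => ?_
    have hT : ∀ l, l ∉ F → roundTime t e s 0 l = (1 - (s 0 l).phase) / (s 0 l).freq := fun l hl => by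
      rw [roundTime, roundStart_zero, lineTime, (hflag l hl).1, htime]
      simp
    rw [hT i hi, hT j hj]
    obtain ⟨a1, a2⟩ := hphase i hi
    obtain ⟨b1, b2⟩ := hphase j hj
    obtain ⟨c1, c2⟩ := hfreq i hi
    obtain ⟨d1, d2⟩ := hfreq j hj
    -- First firing times differ from `1 - φ` by at most `δ`, which is the lone `δ` in the constant.
    have h5 : (1 - (s 0 i).phase) / (s 0 i).freq ≤ 1 - (s 0 i).phase :=
      div_le_self (by linarith) c1
    have h6 : 1 - (s 0 j).phase - δ ≤ (1 - (s 0 j).phase) / (s 0 j).freq := by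
      rw [le_div_iff₀ (by linarith)]
      nlinarith
    have h7 := sub_le_arcLength (φ := fun i => (s 0 i).phase) hphase hj hi
    linarith
  linarith

/-- A normal node that hears no other node keeps its frequency. -/
theorem IsExecution.freq_const (hrun : IsExecution G F f α t e s) {i : V} (hi : i ∉ F)
    (hone : ∀ l, l ∉ F → l = i) (hout : ∀ j ∈ F, j ∉ inNbrs G i) (k : ℕ) :
    (s k i).freq = (s 0 i).freq ∧ ∀ w ∈ (s k i).recv, w = (s 0 i).freq := by
  induction k with
  | zero => simp [(hrun.fresh i hi).2.2.1]
  | succ k ih =>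
    obtain ⟨ih1, ih2⟩ := ih
    have hstep := hrun.step k
    rcases he : e k with j | j | ⟨j, msg⟩
    · simp only [Step, he] at hstep
      obtain ⟨hj, -, hq⟩ := hstep
      obtain rfl := hone j hj
      rw [hq j hi, if_pos rfl]
      split_ifs
      · refine ⟨ih1, fun w hw => ?_⟩
        simp only [Oscillator.receive, Oscillator.fire, Oscillator.flow, Multiset.mem_cons] at hw
        rcases hw with h | h
        · exact h.trans ih1
        · exact ih2 w h
      · exact ⟨ih1, ih2⟩
    · simp only [Step, he] at hstep
      obtain ⟨hj, -, -, ⟨hmain, -, -, hrecv, -⟩, -⟩ := hstep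
      obtain rfl := hone j hj
      refine ⟨?_, by simp [hrecv]⟩
      split_ifs at hmain with hcount
      · exact hmain.2.trans ih1
      · obtain ⟨-, a₀, a, -, -, hsum, hfr⟩ := hmain
        have htrim : ∀ l, (Oscillator.trim (f - (inDeg G j - ((s k j).flow
            (t (k + 1) - t k)).count)) ((s k j).flow (t (k + 1) - t k)).recv).get l =
            (s 0 j).freq := fun l => ih2 _ (mem_of_trim l.2)
        rw [hfr]
        simp only [htrim]
        rw [← Finset.sum_mul]
        exact (congrArg (fun w => a₀ * w + _) ih1).trans (by rw [← add_mul, hsum, one_mul])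
    · simp only [Step, he] at hstep
      obtain ⟨hj, hq⟩ := hstep
      have h1 := hq i hi
      have hadj : ¬ G.Adj i j := mt mem_inNbrs.2 (hout j hj)
      rcases hm : msg i with _ | w
      · simp only [hm] at h1
        rw [h1]
        exact ⟨ih1, ih2⟩
      · simp only [hm, if_neg hadj] at h1
        rw [h1]
        exact ⟨ih1, ih2⟩

theorem resilientSync_of_subsingleton (hrun : IsExecution G F f α t e s)
    (hlocal : IsLocalAttack G F f) (hrobust : IsRobust G (2 * f + 1))
    (hone : ∀ i j, i ∉ F → j ∉ F → i = j)
    (hfreq : ∀ i, i ∉ F → (s 0 i).freq ∈ Set.Icc 1 (1 + δ)) : ResilientSync F δ t s := by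
  refine ⟨fun p _ i hi => ?_, fun p _ => ?_, fun i j hi hj => ?_, fun i j hi hj => ?_⟩
  · have hone' : ∀ l, l ∉ F → l = i := fun l hl => hone l i hl hi
    have h := hrun.freq_const hi hone' (fun j hj => hrobust.not_mem_inNbrs hlocal hi hone' hj) p.1
    rw [freqAt, h.1]
    exact hfreq i hi
  · have : arcLength F (phaseAt t s p) ≤ 0 := by
      refine csInf_le ⟨0, fun L hL => hL.1⟩ ⟨le_rfl, ?_⟩
      by_cases hF : ∃ i, i ∉ F
      · obtain ⟨i, hi⟩ := hF
        refine ⟨phaseAt t s p i, fun j hj => ?_⟩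
        rw [hone j i hj hi, sub_self, Int.fract_zero]
      · exact ⟨0, fun j hj => absurd ⟨j, hj⟩ hF⟩
    exact this.trans_lt (by norm_num)
  · rw [hone i j hi hj]
    simpa using tendsto_const_nhds
  · rw [hone i j hi hj]
    simpa using tendsto_const_nhds

end Main

end PCO

end

theorem theorem2 {V : Type*} [Fintype V] [DecidableEq V]
    (G : Digraph V) (F : Finset V) (f : ℕ) (α δ₀ : ℝ)
    (hα : 0 < α) (hα1 : α ≤ 1)
    (hlocal : PCO.IsLocalAttack G F f)
    (hrobust : PCO.IsRobust G (2 * f + 1))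
    (t : ℕ → ℝ) (e : ℕ → PCO.Event V) (s : ℕ → V → PCO.Oscillator)
    (hrun : PCO.IsExecution G F f α t e s)
    (hphase : ∀ i, i ∉ F → (s 0 i).phase ∈ Set.Ico 0 (1 / 2))
    (hfreq : ∀ i, i ∉ F → (s 0 i).freq ∈ Set.Icc 1 (1 + δ₀))
    (hinit : PCO.arcLength F (fun i => (s 0 i).phase)
      + 4 * (Fintype.card V : ℝ) * (Fᶜ.card : ℝ) / α ^ (2 * Fintype.card V * Fᶜ.card) * δ₀
        < 1 / 2) :
    (∃ k i, PCO.DetectsAt G F e s k i ∧ ∃ j ∈ F, G.Adj i j) ∨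
      PCO.ResilientSync F δ₀ t s := by
  classical
  -- The comparison of constants needs two normal nodes; a single one is isolated from the
  -- attackers.
  by_cases hR : Fᶜ.card ≤ 1
  · refine Or.inr (PCO.resilientSync_of_subsingleton hrun hlocal hrobust (fun i j hi hj => ?_) hfreq)
    exact Finset.card_le_one.1 hR i (by simpa using hi) j (by simpa using hj)
  have hN : Fᶜ.card ≤ Fintype.card V := Finset.card_le_univ _
  have hF : Fᶜ.Nonempty := Finset.card_pos.1 (by omega)
  have hc := PCO.controlled_of_initial (e := e) hα hα1 hF hlocal hrobust hrun.fresh hrun.time_zero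
    hphase hfreq
  have hdeg : ∀ i, i ∉ F → 2 * f + 1 ≤ PCO.inDeg G i ∨ PCO.inNbrs G i = ∅ := fun i _ =>
    hrobust.le_inDeg (by omega) i
  have hbound := PCO.two_mul_div_pow_add_le hα hα1 (show 2 ≤ Fᶜ.card by omega) hN
  obtain ⟨i₀, hi₀⟩ := id hF
  obtain ⟨hδ, hD0⟩ := PCO.RunInv.spread_bounds hc (by simpa using hi₀ : i₀ ∉ F)
  have hmul := mul_le_mul_of_nonneg_right hbound hδ
  set D := PCO.arcLength F (fun i => (s 0 i).phase) + δ₀ + 2 * Fᶜ.card / α ^ Fᶜ.card * δ₀ with hDdef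
  have hD : D + 11 * δ₀ < 1 / 2 := by linarith
  have hinv := fun k => hrun.runInvAt hα.le hc (by linarith) hlocal hdeg
    (fun i hi => (hphase i hi).1) k
  by_cases hdet : ∃ k, ∃ i, PCO.DetectsAt G F e s k i
  · left
    -- At the first detection the invariant still holds, so the excess count can be traced to a
    -- misbehaving in-neighbour.
    obtain ⟨i, hi⟩ := Nat.find_spec hdet
    have h1 := hinv (Nat.find hdet) fun l hl j hj => Nat.find_min hdet hl ⟨j, hj⟩
    obtain ⟨j, hj, hadj⟩ := PCO.RunInv.exists_attacker h1 hi.1 hi.2.2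
    exact ⟨Nat.find hdet, i, hi, j, hj, PCO.mem_inNbrs.1 hadj⟩
  · right
    push Not at hdet
    exact PCO.resilientSync_of_runInvAt hrun hα hα1 hF hlocal hrobust hc (by nlinarith)
      (by linarith) fun k => hinv k fun l _ => hdet l
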